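/- **Theorem 4.1.** *Notation.* Let $n\ge 1$ and let $\mathcal H$ be a complex Hilbert space. For ${\bf p}=(p_1,\dots,p_n)\in\mathbb Z_+^n$ put $|{\bf p}|=p_1+\dots+p_n$, ${\bf p}!=p_1!\cdots p_n!$ and $T^{\bf p}=T_1^{p_1}\cdots T_n^{p_n}$. Let $\mathbb F_n^+$ be the free semigroup with identity on generators $g_1,\dots,g_n$; for $\alpha=g_{i_1}\cdots g_{i_k}$ put $T_\alpha=T_{i_1}\cdots T_{i_k}$ (the identity if $k=0$). Let $\mathbb B_n$ be the open unit ball of $\mathbb C^n$ and $\Lambda_{\bf p}=\{\alpha\in\mathbb F_n^+:\lambda_\alpha=\lambda^{\bf p}\text{ for all }\lambda\in\mathbb B_n\}$. Let $F^2=\bigoplus_{k\ge0}(\mathbb C^n)^{\otimes k}$ be the full Fock space over $\mathbb C^n$, $S_i\varphi=e_i\otimes\varphi$ the left creation operators on it, $F_s^2\subset F^2$ the symmetric Fock space, and $B_i=P_{F_s^2}S_i|_{F_s^2}$ the creation operators on $F_s^2$. All tensor products are Hilbert space tensor products, and infinite series of operators converge in the operator norm. Let $f(\lambda)=\sum_{{\bf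 p}\in\mathbb Z_+^n}\lambda^{\bf p}A_{({\bf p})}$, with $A_{({\bf p})}\in B(\mathcal H)$, be an operator-valued analytic function on $\mathbb B_n$ such that $$\limsup_{k\to\infty}\Big\|\sum_{|{\bf p}|=k}\frac{|{\bf p}|!}{{\bf p}!}A_{({\bf p})}^*A_{({\bf p})}\Big\|^{1/2k}\le 1,$$ $f(0)\ge0$, and $\operatorname{Re} f_{\rm sym}(rS_1,\dots,rS_n)\le I$ for $0\le r<1$, where $$f_{\rm sym}(rS_1,\dots,rS_n)=\sum_{k=0}^\infty\ \sum_{|{\bf p}|=k}\Big(\frac{{\bf p}!}{|{\bf p}|!}\sum_{\alpha\in\Lambda_{\bf p}}r^{|{\bf p}|}S_\alpha\Big)\otimes A_{({\bf p})}.$$ Then: (i) $\Big\|\sum_{|{\bf p}|=k}\frac{{\bf p}!}{|{\bf p}|!}A_{({\bf p})}^*A_{({\bf p})}\Big\|^{1/2}\le 2\|I-A_{(0)}\|$ for $k=1,2,\dots$. (ii) $\sum_{k=0}^\infty r^k\Big\|\sum_{|{\bf p}|=k}\frac{{\bf p}!}{|{\bf p}|!}A_{({\bf p})}^*A_{({\bf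 p})}\Big\|^{1/2}\le\|A_{(0)}\|+\|I-A_{(0)}\|$ for $0\le r\le\frac13$. (iii) If $\mathcal K$ is a complex Hilbert space and $Y_{({\bf p})}\in B(\mathcal K)$, ${\bf p}\in\mathbb Z_+^n$, satisfy $\|Y_{(0)}\|\le1$ and $\sum_{k=1}^\infty\Big\|\sum_{|{\bf p}|=k}\frac{|{\bf p}|!}{{\bf p}!}Y_{({\bf p})}^*Y_{({\bf p})}\Big\|^{1/2}\le\frac12$, then $$\Big\|\sum_{k=0}^\infty\Big(\sum_{|{\bf p}|=k}B^{\bf p}\otimes A_{({\bf p})}\otimes Y_{({\bf p})}\Big)\Big\|\le1,$$ and in particular $\Big\|\sum_{k=0}^\infty\Big(\sum_{|{\bf p}|=k}\lambda^{\bf p}A_{({\bf p})}\otimes Y_{({\bf p})}\Big)\Big\|\le1$ for every $\lambda\in\mathbb B_n$; both series converge in the operator norm. (iv) If $Y_1,\dots,Y_n$ are commuting bounded operators on a complex Hilbert space $\mathcal K$ and the row operator $[Y_1^*,\dots,Y_n^*]:\mathcal K^n\to\mathcal K$ has norm at most $\frac13$, then $\Big\|\sum_{k=0}^\infty\Big(\sum_{|{\bf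 p}|=k}B^{\bf p}\otimes Y^{\bf p}\otimes A_{({\bf p})}\Big)\Big\|\le1$, the series converging in the operator norm. (v) If $T_1,\dots,T_n$ are commuting bounded operators on a complex Hilbert space $\mathcal K$ with $\|T_1T_1^*+\dots+T_nT_n^*\|^{1/2}\le\frac13$, then $\sum_{k=0}^\infty\Big\|\sum_{|{\bf p}|=k}T^{\bf p}\otimes A_{({\bf p})}\Big\|\le\|A_{(0)}\|+\|I-A_{(0)}\|$. -/

import Mathlib

open scoped TensorProduct ENNReal Nat ComplexStarModule
open Filter

noncomputable section

namespace BohrFock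

/-! ### Multi-indices -/

/-- The set `{p ∈ ℤ₊ⁿ : |p| = k}` of multi-indices of degree `k`. -/
def multiIdx (n k : ℕ) : Finset (Fin n → ℕ) := Finset.piAntidiag Finset.univ k

/-- The number `|p|! / p!`, where `|p| = p₁ + ⋯ + pₙ` and `p! = p₁! ⋯ pₙ!`. -/
def multiCoef {n : ℕ} (p : Fin n → ℕ) : ℝ := ((∑ i, p i)! : ℝ) / ((∏ i, (p i)! : ℕ) : ℝ)

/-- The monomial `λ^p = λ₁^{p₁} ⋯ λₙ^{pₙ}` at a point of `ℂⁿ`. -/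
def monomialAt {n : ℕ} (z : EuclideanSpace ℂ (Fin n)) (p : Fin n → ℕ) : ℂ := ∏ i, z i ^ p i

/-- The ordered product `T^p = T₁^{p₁} T₂^{p₂} ⋯ Tₙ^{pₙ}`. -/
def tuplePow {M : Type*} [Monoid M] {n : ℕ} (T : Fin n → M) (p : Fin n → ℕ) : M :=
  (List.ofFn fun i => T i ^ p i).prod

/-! ### The free semigroup and the classes `Λ_p` -/

/-- For a word `α = g_{i₁} ⋯ g_{iₖ}` this is `T_α = T_{i₁} ⋯ T_{iₖ}` (the identity if `α` is the
empty word). -/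
def wordProd {M : Type*} [Monoid M] {n : ℕ} (T : Fin n → M) (α : FreeMonoid (Fin n)) : M :=
  FreeMonoid.lift T α

/-- The set `Λ_p` of the words `α` such that `λ_α = λ^p` for all `λ` in the open unit ball
of `ℂⁿ`. -/
def wordClass {n : ℕ} (p : Fin n → ℕ) : Set (FreeMonoid (Fin n)) :=
  {α | ∀ z ∈ Metric.ball (0 : EuclideanSpace ℂ (Fin n)) 1,
    wordProd (fun i => z i) α = monomialAt z p}

theorem wordProd_const {n : ℕ} (c : ℂ) (α : FreeMonoid (Fin n)) :
    wordProd (fun _ => c) α = c ^ α.length := by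
  induction α using FreeMonoid.inductionOn' with
  | one => simp [wordProd]
  | of_mul i β ih =>
    simp only [wordProd] at ih ⊢
    rw [map_mul, ih, FreeMonoid.lift_eval_of, FreeMonoid.length_mul, FreeMonoid.length_of, pow_add,
      pow_one]

theorem length_of_mem_wordClass {n : ℕ} {p : Fin n → ℕ} {α : FreeMonoid (Fin n)}
    (h : α ∈ wordClass p) : α.length = ∑ i, p i := by
  have hpos : (0 : ℝ) < (n : ℝ) + 2 := by positivity
  set c : ℝ := ((n : ℝ) + 2)⁻¹ with hc
  have hc0 : 0 < c := by positivity
  have hc1 : c < 1 := inv_lt_one_of_one_lt₀ (by linarith [(Nat.cast_nonneg n : (0 : ℝ) ≤ n)])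
  have hz := h (WithLp.toLp 2 fun _ => (c : ℂ)) (by
    rw [mem_ball_zero_iff, EuclideanSpace.norm_eq, Real.sqrt_lt' one_pos]
    simp only [Complex.norm_real, Real.norm_eq_abs, sq_abs, Finset.sum_const, Finset.card_univ,
      Fintype.card_fin, nsmul_eq_mul, one_pow]
    have h1 : ((n : ℝ) + 2) * c = 1 := by rw [hc]; field_simp
    nlinarith)
  have e : (c : ℂ) ^ α.length = (c : ℂ) ^ (∑ i, p i) := by
    rw [← wordProd_const, ← Finset.prod_pow_eq_pow_sum]
    simpa [monomialAt] using hz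
  have e' : c ^ α.length = c ^ (∑ i, p i) := by exact_mod_cast e
  exact (pow_right_injective₀ hc0 hc1.ne) e'

theorem wordClass_finite {n : ℕ} (p : Fin n → ℕ) : (wordClass p).Finite :=
  (List.finite_length_eq (Fin n) (∑ i, p i)).subset fun _ h => length_of_mem_wordClass h

/-! ### The full Fock space and the left creation operators -/

/-- The full Fock space `F²(Hₙ) = ⨁ₖ Hₙ^{⊗k}` of `Hₙ = ℂⁿ`, in coordinates with respect to its
orthonormal basis `e_α = e_{i₁} ⊗ ⋯ ⊗ e_{iₖ}`, `α = g_{i₁} ⋯ g_{iₖ}` (the vacuum vector if `α` is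
the empty word). -/
abbrev Fock (n : ℕ) : Type := lp (fun _ : FreeMonoid (Fin n) => ℂ) 2

/-- Coordinates of `e_i ⊗ u`: the value at `g_i β` is `u β`, and the value at any word that does
not start with `g_i` is `0`. -/
def shiftFun {n : ℕ} (i : Fin n) (u : FreeMonoid (Fin n) → ℂ) : FreeMonoid (Fin n) → ℂ :=
  Function.extend (fun β => FreeMonoid.of i * β) u 0

theorem of_mul_injective {n : ℕ} (i : Fin n) :
    Function.Injective fun β : FreeMonoid (Fin n) => FreeMonoid.of i * β :=
  fun _ _ h => List.cons_injective h

theorem shiftFun_of_mul {n : ℕ} (i : Fin n) (u : FreeMonoid (Fin n) → ℂ)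
    (β : FreeMonoid (Fin n)) : shiftFun i u (FreeMonoid.of i * β) = u β :=
  (of_mul_injective i).extend_apply u 0 β

theorem shiftFun_of_not_exists {n : ℕ} {i : Fin n} {u : FreeMonoid (Fin n) → ℂ}
    {α : FreeMonoid (Fin n)} (h : ¬∃ β, FreeMonoid.of i * β = α) : shiftFun i u α = 0 := by
  simp [shiftFun, Function.extend_apply' _ _ _ h]

theorem norm_shiftFun {n : ℕ} (i : Fin n) (u : FreeMonoid (Fin n) → ℂ) :
    (fun α => ‖shiftFun i u α‖ ^ (2 : ℝ)) =
      Function.extend (fun β => FreeMonoid.of i * β) (fun β => ‖u β‖ ^ (2 : ℝ)) 0 := by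
  funext α
  by_cases h : ∃ β, FreeMonoid.of i * β = α
  · obtain ⟨β, rfl⟩ := h
    have e1 := (of_mul_injective i).extend_apply u 0 β
    have e2 := (of_mul_injective i).extend_apply (fun β => ‖u β‖ ^ (2 : ℝ)) 0 β
    simp only [shiftFun]
    exact (congrArg (fun x : ℂ => ‖x‖ ^ (2 : ℝ)) e1).trans e2.symm
  · simp [shiftFun, Function.extend_apply' _ _ _ h]

/-- The left creation operator `S_i u = e_i ⊗ u`, as an isometry. -/
def creationIsometry {n : ℕ} (i : Fin n) : Fock n →ₗᵢ[ℂ] Fock n where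
  toFun u := ⟨shiftFun i u, by
    have h := (lp.memℓp u).summable (by norm_num)
    refine memℓp_gen ?_
    have h2 : (2 : ℝ≥0∞).toReal = (2 : ℝ) := by norm_num
    rw [h2] at h ⊢
    rw [norm_shiftFun]
    exact ((hasSum_extend_zero (of_mul_injective i)).2 h.hasSum).summable⟩
  map_add' u v := by
    ext α
    change shiftFun i (u + v) α = shiftFun i u α + shiftFun i v α
    by_cases h : ∃ β, FreeMonoid.of i * β = α
    · obtain ⟨β, rfl⟩ := h
      simp only [shiftFun_of_mul, Pi.add_apply]
    · simp only [shiftFun_of_not_exists h, add_zero]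
  map_smul' c u := by
    ext α
    change shiftFun i (c • u) α = c * shiftFun i u α
    by_cases h : ∃ β, FreeMonoid.of i * β = α
    · obtain ⟨β, rfl⟩ := h
      simp only [shiftFun_of_mul, Pi.smul_apply, smul_eq_mul]
    · simp only [shiftFun_of_not_exists h, mul_zero]
  norm_map' u := by
    have h : Summable fun β => ‖u β‖ ^ (2 : ℝ) := by
      simpa using (lp.memℓp u).summable (by norm_num)
    have key : ∑' α, ‖shiftFun i u α‖ ^ (2 : ℝ) = ∑' β, ‖u β‖ ^ (2 : ℝ) := by
      rw [norm_shiftFun]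
      exact ((hasSum_extend_zero (of_mul_injective i)).2 h.hasSum).tsum_eq
    rw [lp.norm_eq_tsum_rpow (by norm_num), lp.norm_eq_tsum_rpow (by norm_num)]
    have h2 : (2 : ℝ≥0∞).toReal = (2 : ℝ) := by norm_num
    simp only [h2]
    exact congrArg (fun x : ℝ => x ^ (1 / (2 : ℝ))) key

/-- The left creation operator `S_i` on the full Fock space. -/
def leftCreation {n : ℕ} (i : Fin n) : Fock n →L[ℂ] Fock n :=
  (creationIsometry i).toContinuousLinearMap

/-! ### The symmetric Fock space -/

/-- The symmetric Fock space `F_s²(Hₙ) ⊆ F²(Hₙ)`: the vectors whose coordinates are invariant under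
permutations of the letters of a word. -/
def symFock (n : ℕ) : Submodule ℂ (Fock n) where
  carrier := {u | ∀ α β : FreeMonoid (Fin n), α.toList.Perm β.toList → u α = u β}
  add_mem' h₁ h₂ α β hp := by simp [h₁ α β hp, h₂ α β hp]
  zero_mem' α β _ := by simp
  smul_mem' c u h α β hp := by simp [h α β hp]

theorem isClosed_symFock (n : ℕ) : IsClosed (symFock n : Set (Fock n)) := by
  have h : (symFock n : Set (Fock n)) =
      ⋂ (α : FreeMonoid (Fin n)) (β : FreeMonoid (Fin n)) (_ : α.toList.Perm β.toList),
        {u : Fock n | u α = u β} := by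
    ext u
    simp only [Set.mem_iInter]
    rfl
  rw [h]
  refine isClosed_iInter fun α => isClosed_iInter fun β => isClosed_iInter fun _ => ?_
  exact isClosed_eq (lp.evalCLM ℂ (fun _ : FreeMonoid (Fin n) => ℂ) 2 α).continuous
    (lp.evalCLM ℂ (fun _ : FreeMonoid (Fin n) => ℂ) 2 β).continuous

instance instCompleteSpaceSymFock (n : ℕ) : CompleteSpace (symFock n) :=
  (isClosed_symFock n).completeSpace_coe

/-- The creation operator `B_i = P_{F_s²} S_i |_{F_s²}` on the symmetric Fock space. -/
def symCreation {n : ℕ} (i : Fin n) : symFock n →L[ℂ] symFock n :=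
  (symFock n).orthogonalProjectionOnto ∘L leftCreation i ∘L (symFock n).subtypeL

/-! ### Hilbert space tensor products -/

section Tensor

variable (E F : Type*) [NormedAddCommGroup E] [InnerProductSpace ℂ E]
  [NormedAddCommGroup F] [InnerProductSpace ℂ F]

/-- The Hilbert space tensor product: the completion of the algebraic tensor product, normed by
`⟪a ⊗ b, c ⊗ d⟫ = ⟪a, c⟫ ⟪b, d⟫`. -/
def HTensor : Type _ := UniformSpace.Completion (E ⊗[ℂ] F)

instance instNormedAddCommGroupHTensor : NormedAddCommGroup (HTensor E F) :=
  inferInstanceAs (NormedAddCommGroup (UniformSpace.Completion (E ⊗[ℂ] F)))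

instance instInnerProductSpaceHTensor : InnerProductSpace ℂ (HTensor E F) :=
  inferInstanceAs (InnerProductSpace ℂ (UniformSpace.Completion (E ⊗[ℂ] F)))

instance instCompleteSpaceHTensor : CompleteSpace (HTensor E F) :=
  inferInstanceAs (CompleteSpace (UniformSpace.Completion (E ⊗[ℂ] F)))

variable {E F}

/-- The operator `T ⊗ A` on the Hilbert space tensor product. -/
def opTensor (T : E →L[ℂ] E) (A : F →L[ℂ] F) : HTensor E F →L[ℂ] HTensor E F :=
  (TensorProduct.mapL T A).completion

end Tensor

/-- The row operator `[T₁, …, Tₙ] : Kⁿ → K`, `(x₁, …, xₙ) ↦ T₁ x₁ + ⋯ + Tₙ xₙ`, where `Kⁿ` is the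
Hilbert space direct sum. -/
def rowOp {K : Type*} [NormedAddCommGroup K] [InnerProductSpace ℂ K] {n : ℕ}
    (T : Fin n → K →L[ℂ] K) : PiLp 2 (fun _ : Fin n => K) →L[ℂ] K :=
  ∑ i, T i ∘L PiLp.proj 2 (fun _ : Fin n => K) i

/-! ### The symmetrized functional calculus -/

section Calculus

variable {n : ℕ} {E H : Type*}
  [NormedAddCommGroup E] [InnerProductSpace ℂ E] [NormedAddCommGroup H] [InnerProductSpace ℂ H]

/-- `(λ^p)_sym(X₁, …, Xₙ) = (p! / |p|!) ∑_{α ∈ Λ_p} X_α`. -/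
def symMonomial (X : Fin n → E →L[ℂ] E) (p : Fin n → ℕ) : E →L[ℂ] E :=
  (((multiCoef p)⁻¹ : ℝ) : ℂ) • ∑ α ∈ (wordClass_finite p).toFinset, wordProd X α

/-- `f_sym(X₁, …, Xₙ) = ∑ₖ ∑_{|p| = k} (λ^p)_sym(X₁, …, Xₙ) ⊗ A_p` for the power series
`f = ∑ₚ λ^p A_p`. -/
def symCalculus (A : (Fin n → ℕ) → H →L[ℂ] H) (X : Fin n → E →L[ℂ] E) :
    HTensor E H →L[ℂ] HTensor E H :=
  ∑' k : ℕ, ∑ p ∈ multiIdx n k, opTensor (symMonomial X p) (A p)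

end Calculus

end BohrFock

end

open BohrFock

open BohrFock

noncomputable section

namespace BohrFock

/-! ### Words and their contents -/

/-! The scalar model is the Carathéodory-type bound `|a_k| ≤ 2(1 - a_0)` for a power series with
real part at most `1` and `a_0 ≥ 0`. Summing it against `3^{-k}` gives Bohr's radius, because `2(1/3
+ 1/9 + ⋯) = 1`.

The operator version comes from testing `Re f_sym(rS) ≤ I` on vectors living in degrees `0` and `k`
only. Creation operators raise the degree, so only the constant and the degree-`k` parts of the
series are seen. Letting `r → 1` leaves a quadratic inequality between the `A_q` with `|q| = k` and
`I - A_0` (`coeff_inequality`). Optimizing the test vector turns it into `CoeffBound`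
(`coeffBound`): whenever `R` is selfadjoint and `R(I - A_0)R ≤ c`, the column of the `R A_p R`, with
weights `p!/|p|!`, has norm at most `2c`.

Taking `R = I` and `c` close to `‖I - A_0‖` gives the coefficient bound (i), and a geometric series
gives (ii). For (v), `T^p` is a row of norm at most `3^{-k}` in degree `k` with weights `|p|!/p!`,
and the Cauchy–Schwarz inequality for a row times a column reduces the claim to (ii).

Parts (iii) and (iv) need the sharper choice `R = (I - A_0 + ε)^{-1/2}`, `c = 1`. With `s = R⁻¹` one
has `A_p = s G_p s`, where the columns of the `G_p` have norm at most `2`. Against coefficients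
`Y_p` of total column norm at most `1/2`, the terms of positive degree add up to `s G s` with `G` a
contraction. The whole series is then `A_0^{1/2} Y_0 A_0^{1/2} + s G s`, and `A_0 + s² = 1 + ε`
bounds its norm by `1 + ε` (`norm_tsum_map_le_one`). Part (iv) is the case `Y_p = Y^p`. -/

instance instDecidableEqFreeMonoidFin (n : ℕ) : DecidableEq (FreeMonoid (Fin n)) :=
  inferInstanceAs (DecidableEq (List (Fin n)))

/-- The multi-index counting the occurrences of each generator in a word. -/
def content {n : ℕ} (α : FreeMonoid (Fin n)) : Fin n → ℕ := fun i => α.toList.count i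

theorem content_one {n : ℕ} : content (1 : FreeMonoid (Fin n)) = 0 := rfl

theorem content_of_mul {n : ℕ} (i : Fin n) (α : FreeMonoid (Fin n)) :
    content (FreeMonoid.of i * α) = Pi.single i 1 + content α := by
  funext j
  simp only [content, FreeMonoid.toList_of_mul, List.count_cons, Pi.add_apply, Pi.single_apply,
    beq_iff_eq, add_comm]
  simp only [eq_comm]

theorem wordProd_one {M : Type*} [Monoid M] {n : ℕ} (T : Fin n → M) : wordProd T 1 = 1 :=
  map_one _

theorem wordProd_of_mul {M : Type*} [Monoid M] {n : ℕ} (T : Fin n → M) (i : Fin n)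
    (α : FreeMonoid (Fin n)) : wordProd T (FreeMonoid.of i * α) = T i * wordProd T α := by
  simp [wordProd]

theorem sum_content {n : ℕ} (α : FreeMonoid (Fin n)) : ∑ i, content α i = α.length := by
  induction α using FreeMonoid.inductionOn' with
  | one => simp [content_one]
  | of_mul i β ih => simp [content_of_mul, Finset.sum_add_distrib, ih]

theorem wordProd_eq_prod {M : Type*} [CommMonoid M] {n : ℕ} (z : Fin n → M)
    (α : FreeMonoid (Fin n)) : wordProd z α = ∏ i, z i ^ content α i := by
  induction α using FreeMonoid.inductionOn' with
  | one => simp [content_one, wordProd_one]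
  | of_mul i β ih =>
    rw [wordProd_of_mul, ih, content_of_mul]
    simp only [Pi.add_apply, pow_add, Finset.prod_mul_distrib]
    congr 1
    rw [Finset.prod_eq_single i] <;> simp +contextual

/-- Monomials are separated by their values at the points of the ball with `i`-th coordinate `c/2`
and all others `c`: there a monomial `q` equals `c^|q| (1/2)^(q i)`, and the degrees are already
known to agree. -/
theorem mem_wordClass_iff {n : ℕ} {p : Fin n → ℕ} {α : FreeMonoid (Fin n)} :
    α ∈ wordClass p ↔ content α = p := by
  constructor
  · intro h
    have hlen := length_of_mem_wordClass h
    funext i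
    set c : ℝ := ((n : ℝ) + 2)⁻¹ with hc
    have hc0 : 0 < c := by positivity
    have hc1 : c < 1 := inv_lt_one_of_one_lt₀ (by linarith [(Nat.cast_nonneg n : (0 : ℝ) ≤ n)])
    set w : Fin n → ℝ := fun j => c * if j = i then 1 / 2 else 1 with hw
    have hwc : ∀ j, w j ^ 2 ≤ c ^ 2 := by
      intro j
      have h0 : 0 ≤ w j := by simp only [hw]; split_ifs <;> positivity
      have h1 : w j ≤ c := by simp only [hw]; split_ifs <;> linarith
      gcongr
    have hz := h (WithLp.toLp 2 fun j => (w j : ℂ)) (by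
      rw [mem_ball_zero_iff, EuclideanSpace.norm_eq, Real.sqrt_lt' one_pos]
      simp only [Complex.norm_real, Real.norm_eq_abs, sq_abs, one_pow]
      have h2 := Finset.sum_le_sum fun j (_ : j ∈ Finset.univ) => hwc j
      simp only [Finset.sum_const, Finset.card_univ, Fintype.card_fin, nsmul_eq_mul] at h2
      have h1 : ((n : ℝ) + 2) * c = 1 := by rw [hc]; field_simp
      nlinarith)
    rw [wordProd_eq_prod] at hz
    have hz' : ∏ j, w j ^ content α j = ∏ j, w j ^ p j := by
      have : ∏ j, (w j : ℂ) ^ content α j = ∏ j, (w j : ℂ) ^ p j := by simpa [monomialAt] using hz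
      exact_mod_cast this
    have key : ∀ q : Fin n → ℕ, ∏ j, w j ^ q j = c ^ (∑ j, q j) * (1 / 2) ^ q i := by
      intro q
      simp only [hw, mul_pow, Finset.prod_mul_distrib, Finset.prod_pow_eq_pow_sum]
      congr 1
      rw [Finset.prod_eq_single i] <;> simp +contextual
    rw [key, key, sum_content, hlen] at hz'
    have h3 := mul_left_cancel₀ (pow_pos hc0 _).ne' hz'
    exact pow_right_injective₀ (by norm_num) (by norm_num) h3
  · rintro rfl z -
    rw [wordProd_eq_prod]; rfl

/-- The finite set of words of length `k`. -/
def words (n : ℕ) : ℕ → Finset (FreeMonoid (Fin n))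
  | 0 => {1}
  | k + 1 => ((Finset.univ : Finset (Fin n)) ×ˢ words n k).map
      ⟨fun x => FreeMonoid.of x.1 * x.2, fun x y h => by
        have h' := List.cons.inj h
        exact Prod.ext h'.1 h'.2⟩

theorem sum_words_succ {M : Type*} [AddCommMonoid M] {n k : ℕ} (F : FreeMonoid (Fin n) → M) :
    ∑ α ∈ words n (k + 1), F α = ∑ i, ∑ α ∈ words n k, F (FreeMonoid.of i * α) := by
  rw [words, Finset.sum_map, Finset.sum_product]
  rfl

theorem mem_words_succ {n k : ℕ} {α : FreeMonoid (Fin n)} :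
    α ∈ words n (k + 1) ↔ ∃ i, ∃ β ∈ words n k, FreeMonoid.of i * β = α := by
  rw [words, Finset.mem_map]
  constructor
  · rintro ⟨x, hx, rfl⟩
    exact ⟨x.1, x.2, (Finset.mem_product.1 hx).2, rfl⟩
  · rintro ⟨i, β, hβ, rfl⟩
    exact ⟨(i, β), Finset.mem_product.2 ⟨Finset.mem_univ _, hβ⟩, rfl⟩

theorem mem_words {n k : ℕ} {α : FreeMonoid (Fin n)} : α ∈ words n k ↔ α.length = k := by
  induction k generalizing α with
  | zero => simp [words]
  | succ k ih =>
    rw [mem_words_succ]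
    constructor
    · rintro ⟨i, β, hβ, rfl⟩
      rw [FreeMonoid.length_mul, FreeMonoid.length_of, ih.1 hβ, add_comm]
    · induction α using FreeMonoid.inductionOn' with
      | one => intro h; simp at h
      | of_mul i β _ =>
        intro h
        rw [FreeMonoid.length_mul, FreeMonoid.length_of] at h
        exact ⟨i, β, ih.2 (by omega), rfl⟩

theorem mem_multiIdx {n k : ℕ} {p : Fin n → ℕ} : p ∈ multiIdx n k ↔ ∑ i, p i = k := by
  simp [multiIdx, Finset.mem_piAntidiag]

theorem multiIdx_zero (n : ℕ) : multiIdx n 0 = {0} := by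
  simp [multiIdx]

/-- The finite set `Λ_p`. -/
def wordFin {n : ℕ} (p : Fin n → ℕ) : Finset (FreeMonoid (Fin n)) :=
  (wordClass_finite p).toFinset

theorem mem_wordFin {n : ℕ} {p : Fin n → ℕ} {α : FreeMonoid (Fin n)} :
    α ∈ wordFin p ↔ content α = p := by
  rw [wordFin, Set.Finite.mem_toFinset, mem_wordClass_iff]

theorem sum_multiIdx_sum_wordFin {M : Type*} [AddCommMonoid M] {n k : ℕ}
    (F : FreeMonoid (Fin n) → M) :
    ∑ p ∈ multiIdx n k, ∑ α ∈ wordFin p, F α = ∑ α ∈ words n k, F α := by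
  rw [← Finset.sum_fiberwise_of_maps_to (g := content) (t := multiIdx n k)
    (fun α hα => by rw [mem_multiIdx, sum_content, mem_words.1 hα])]
  refine Finset.sum_congr rfl fun p hp => Finset.sum_congr ?_ fun _ _ => rfl
  ext α
  rw [mem_wordFin, Finset.mem_filter, mem_words]
  constructor
  · rintro rfl
    exact ⟨by rw [← sum_content, mem_multiIdx.1 hp], rfl⟩
  · exact fun h => h.2

theorem sum_words_wordProd {R : Type*} [Semiring R] {n : ℕ} (x : Fin n → R) (k : ℕ) :
    ∑ α ∈ words n k, wordProd x α = (∑ i, x i) ^ k := by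
  induction k with
  | zero => simp [words, wordProd_one]
  | succ k ih =>
    rw [sum_words_succ, pow_succ', ← ih, Finset.sum_mul]
    simp only [wordProd_of_mul, Finset.mul_sum]

/-- Expanding `(X_1 + ⋯ + X_n)^k` once over words and once by the multinomial theorem gives the same
polynomial; compare coefficients. -/
theorem card_wordFin_eq_multinomial {n : ℕ} (p : Fin n → ℕ) :
    (wordFin p).card = Nat.multinomial Finset.univ p := by
  set k := ∑ i, p i with hk
  have h1 := sum_words_wordProd (fun i : Fin n => (MvPolynomial.X i : MvPolynomial (Fin n) ℕ)) k
  rw [Finset.sum_pow_eq_sum_piAntidiag, ← sum_multiIdx_sum_wordFin] at h1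
  have h2 := congrArg (MvPolynomial.coeff (Finsupp.equivFunOnFinite.symm p)) h1
  have mono : ∀ q : Fin n → ℕ, ∏ i, (MvPolynomial.X i : MvPolynomial (Fin n) ℕ) ^ q i =
      MvPolynomial.monomial (Finsupp.equivFunOnFinite.symm q) 1 := by
    intro q
    rw [MvPolynomial.monomial_eq, Finsupp.prod_fintype _ _ (by simp)]
    simp
  have h3 : ∀ q ∈ multiIdx n k, ∑ α ∈ wordFin q,
      wordProd (fun i : Fin n => (MvPolynomial.X i : MvPolynomial (Fin n) ℕ)) α =
      ((wordFin q).card : MvPolynomial (Fin n) ℕ) *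
        MvPolynomial.monomial (Finsupp.equivFunOnFinite.symm q) 1 := by
    intro q _
    rw [← nsmul_eq_mul, ← Finset.sum_const]
    refine Finset.sum_congr rfl fun α hα => ?_
    rw [wordProd_eq_prod, mem_wordFin.1 hα, mono]
  rw [Finset.sum_congr rfl h3] at h2
  have hp : p ∈ multiIdx n k := mem_multiIdx.2 rfl
  simp only [mono, MvPolynomial.coeff_sum, ← nsmul_eq_mul, MvPolynomial.coeff_smul,
    MvPolynomial.coeff_monomial, EmbeddingLike.apply_eq_iff_eq] at h2
  simpa [hp, multiIdx, ← hk] using h2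

theorem card_wordFin {n : ℕ} (p : Fin n → ℕ) : ((wordFin p).card : ℝ) = multiCoef p := by
  have h := Nat.multinomial_spec Finset.univ p
  rw [card_wordFin_eq_multinomial, multiCoef, eq_div_iff, mul_comm]
  · exact_mod_cast h
  · exact_mod_cast Finset.prod_ne_zero_iff.2 fun i _ => Nat.factorial_ne_zero _

theorem one_le_multiCoef {n : ℕ} (p : Fin n → ℕ) : 1 ≤ multiCoef p := by
  rw [← card_wordFin, card_wordFin_eq_multinomial]
  exact_mod_cast Nat.multinomial_pos _ _

theorem multiCoef_pos {n : ℕ} (p : Fin n → ℕ) : 0 < multiCoef p :=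
  one_pos.trans_le (one_le_multiCoef p)

theorem multiCoef_zero {n : ℕ} : multiCoef (0 : Fin n → ℕ) = 1 := by
  simp [multiCoef]

theorem wordFin_zero {n : ℕ} : wordFin (0 : Fin n → ℕ) = {1} := by
  have h : (wordFin (0 : Fin n → ℕ)).card = 1 := by
    have := card_wordFin (0 : Fin n → ℕ)
    rw [multiCoef_zero] at this
    exact_mod_cast this
  obtain ⟨α, hα⟩ := Finset.card_eq_one.1 h
  have h1 : (1 : FreeMonoid (Fin n)) ∈ wordFin (0 : Fin n → ℕ) := mem_wordFin.2 content_one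
  rw [hα, Finset.mem_singleton] at h1
  rw [hα, h1]

/-! ### Ordered products of commuting tuples -/

theorem tuplePow_succ {M : Type*} [Monoid M] {n : ℕ} (T : Fin (n + 1) → M) (p : Fin (n + 1) → ℕ) :
    tuplePow T p = T 0 ^ p 0 * tuplePow (fun i => T i.succ) (fun i => p i.succ) := by
  simp [tuplePow, List.ofFn_succ]

theorem tuplePow_zero {M : Type*} [Monoid M] {n : ℕ} (T : Fin n → M) : tuplePow T 0 = 1 := by
  simp [tuplePow, List.ofFn_const]

theorem Commute.tuplePow_right {M : Type*} [Monoid M] {n : ℕ} {T : Fin n → M} {a : M}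
    (h : ∀ i, Commute a (T i)) (p : Fin n → ℕ) : Commute a (tuplePow T p) := by
  refine Commute.list_prod_right _ _ fun b hb => ?_
  obtain ⟨i, rfl⟩ := (List.mem_ofFn' _ _).1 hb
  exact (h i).pow_right _

theorem tuplePow_single_add {M : Type*} [Monoid M] {n : ℕ} {T : Fin n → M}
    (h : ∀ i j, Commute (T i) (T j)) (i : Fin n) (p : Fin n → ℕ) :
    tuplePow T (Pi.single i 1 + p) = T i * tuplePow T p := by
  induction n with
  | zero => exact i.elim0
  | succ n ih =>
    rw [tuplePow_succ, tuplePow_succ]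
    induction i using Fin.cases with
    | zero =>
      rw [← mul_assoc, ← pow_succ']
      simp [add_comm, Fin.succ_ne_zero]
    | succ i =>
      have e : (fun j : Fin n => (Pi.single i.succ 1 + p : Fin (n + 1) → ℕ) j.succ) =
          Pi.single i 1 + fun j => p j.succ := by
        funext j; simp [Pi.single_apply]
      rw [e, ih (fun _ _ => h _ _), ← mul_assoc, ← mul_assoc, ((h i.succ 0).pow_right _).eq]
      simp [(Fin.succ_ne_zero i).symm]

theorem wordProd_eq_tuplePow {M : Type*} [Monoid M] {n : ℕ} {T : Fin n → M}
    (h : ∀ i j, Commute (T i) (T j)) (α : FreeMonoid (Fin n)) :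
    wordProd T α = tuplePow T (content α) := by
  induction α using FreeMonoid.inductionOn' with
  | one => rw [wordProd_one, content_one, tuplePow_zero]
  | of_mul i β ih => rw [wordProd_of_mul, ih, content_of_mul, tuplePow_single_add h]

theorem star_tuplePow {M : Type*} [Monoid M] [StarMul M] {n : ℕ} {T : Fin n → M}
    (h : ∀ i j, Commute (T i) (T j)) (p : Fin n → ℕ) :
    star (tuplePow T p) = tuplePow (fun i => star (T i)) p := by
  induction n with
  | zero => simp [tuplePow]
  | succ n ih =>
    have hc : Commute (T 0 ^ p 0) (tuplePow (fun i => T i.succ) (fun i => p i.succ)) :=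
      Commute.tuplePow_right (fun i => (h 0 i.succ).pow_left _) _
    rw [tuplePow_succ, tuplePow_succ, hc.eq, star_mul, star_pow, ih (fun _ _ => h _ _)]

/-! ### Symmetrized monomials -/

/-- The symmetrized monomial `(p! / |p|!) ∑_{α ∈ Λ_p} T_α`. -/
def symMono {L : Type*} [CStarAlgebra L] {n : ℕ} (T : Fin n → L) (p : Fin n → ℕ) : L :=
  (multiCoef p)⁻¹ • ∑ α ∈ wordFin p, wordProd T α

theorem symMono_zero {L : Type*} [CStarAlgebra L] {n : ℕ} (T : Fin n → L) : symMono T 0 = 1 := by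
  rw [symMono, wordFin_zero, Finset.sum_singleton, wordProd_one, multiCoef_zero, inv_one, one_smul]

theorem symMono_eq_tuplePow {L : Type*} [CStarAlgebra L] {n : ℕ} {T : Fin n → L} (h : ∀ i j, Commute (T i) (T j))
    (p : Fin n → ℕ) : symMono T p = tuplePow T p := by
  have e : ∑ α ∈ wordFin p, wordProd T α = multiCoef p • tuplePow T p := by
    rw [← card_wordFin, Nat.cast_smul_eq_nsmul, ← Finset.sum_const]
    exact Finset.sum_congr rfl fun α hα => by
      rw [wordProd_eq_tuplePow h, mem_wordFin.1 hα]
  rw [symMono, e, smul_smul, inv_mul_cancel₀ (multiCoef_pos p).ne', one_smul]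

/-! ### Rows and columns in a C⋆-algebra -/

section CStar

variable {L : Type*} [CStarAlgebra L] [PartialOrder L] [StarOrderedRing L]

/-- The Cauchy–Schwarz inequality for the product of a row and a column. -/
theorem norm_sum_mul_le_row_mul_col {ι : Type*} (s : Finset ι) (a b : ι → L) :
    ‖∑ i ∈ s, a i * b i‖ ≤
      √‖∑ i ∈ s, a i * star (a i)‖ * √‖∑ i ∈ s, star (b i) * b i‖ := by
  -- This is Cauchy–Schwarz in the Hilbert C⋆-module `L^s`, whose inner product of `x` and `y` is `∑
  -- y i * star (x i)`; hence the star on `b`.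
  let x : WithCStarModule L (s → L) :=
    (WithCStarModule.equiv L (s → L)).symm fun i => star (b i)
  let y : WithCStarModule L (s → L) := (WithCStarModule.equiv L (s → L)).symm fun i => a i
  have h := CStarModule.norm_inner_le (A := L) (WithCStarModule L (s → L)) (x := x) (y := y)
  rw [WithCStarModule.pi_norm, WithCStarModule.pi_norm, WithCStarModule.pi_inner, mul_comm] at h
  simp only [x, y, WithCStarModule.inner_def, WithCStarModule.equiv_symm_pi_apply, star_star] at h
  rw [← Finset.sum_coe_sort s, ← Finset.sum_coe_sort s, ← Finset.sum_coe_sort s]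
  exact h

/-- Peeling off the first letter conjugates the sum for degree `k` by each `T i`, and conjugation
preserves order. -/
theorem sum_wordProd_mul_star_le {n : ℕ} {T : Fin n → L} {c : ℝ}
    (h : ∑ i, T i * star (T i) ≤ c • (1 : L)) (hc : 0 ≤ c) (k : ℕ) :
    ∑ α ∈ words n k, wordProd T α * star (wordProd T α) ≤ c ^ k • (1 : L) := by
  induction k with
  | zero => simp [words, wordProd_one]
  | succ k ih =>
    rw [sum_words_succ]
    calc ∑ i, ∑ α ∈ words n k,
          wordProd T (FreeMonoid.of i * α) * star (wordProd T (FreeMonoid.of i * α))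
        = ∑ i, T i * (∑ α ∈ words n k, wordProd T α * star (wordProd T α)) * star (T i) := by
          refine Finset.sum_congr rfl fun i _ => ?_
          simp only [wordProd_of_mul, star_mul, Finset.mul_sum, Finset.sum_mul, mul_assoc]
      _ ≤ ∑ i, T i * (c ^ k • (1 : L)) * star (T i) :=
          Finset.sum_le_sum fun i _ => star_right_conjugate_le_conjugate ih _
      _ = c ^ k • ∑ i, T i * star (T i) := by
          simp only [Finset.smul_sum, mul_smul_comm, smul_mul_assoc, mul_one]
      _ ≤ c ^ k • (c • (1 : L)) := smul_le_smul_of_nonneg_left h (by positivity)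
      _ = c ^ (k + 1) • (1 : L) := by rw [smul_smul, pow_succ]

/-- Positivity of the variance: expand the sum of the squares of the deviations of the `a i` from
their mean. -/
theorem sum_mul_star_sum_le {ι : Type*} (s : Finset ι) (a : ι → L) :
    (s.card : ℝ)⁻¹ • ((∑ i ∈ s, a i) * star (∑ i ∈ s, a i)) ≤ ∑ i ∈ s, a i * star (a i) := by
  rcases s.eq_empty_or_nonempty with rfl | hs
  · simp
  have hN : (s.card : ℝ) ≠ 0 := by exact_mod_cast hs.card_pos.ne'
  set N : ℝ := (s.card : ℝ) with hNd
  set b : L := ∑ i ∈ s, a i with hb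
  have h : 0 ≤ ∑ i ∈ s, (a i - N⁻¹ • b) * star (a i - N⁻¹ • b) :=
    Finset.sum_nonneg fun i _ => mul_star_self_nonneg _
  have e : ∑ i ∈ s, (a i - N⁻¹ • b) * star (a i - N⁻¹ • b) =
      ∑ i ∈ s, a i * star (a i) - N⁻¹ • (b * star b) := by
    have e1 : ∀ i, (a i - N⁻¹ • b) * star (a i - N⁻¹ • b) = a i * star (a i) -
        N⁻¹ • (a i * star b) - N⁻¹ • (b * star (a i)) + N⁻¹ • N⁻¹ • (b * star b) := by
      intro i
      simp only [star_sub, star_smul, star_trivial, sub_mul, mul_sub, smul_mul_assoc,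
        mul_smul_comm, smul_sub]
      abel
    simp only [e1, Finset.sum_add_distrib, Finset.sum_sub_distrib, ← Finset.smul_sum,
      ← Finset.sum_mul, ← Finset.mul_sum, ← star_sum, ← hb, Finset.sum_const]
    rw [← Nat.cast_smul_eq_nsmul ℝ, ← hNd, smul_mul_assoc, smul_smul N⁻¹ N, inv_mul_cancel₀ hN,
      one_smul]
    abel
  rw [e] at h
  exact sub_nonneg.1 h

/-- Averaging over a class `Λ_p` only decreases the row sum over words, and the class has exactly
`multiCoef p` elements, which accounts for the weight. -/
theorem sum_symMono_mul_star_le {n : ℕ} {T : Fin n → L} {c : ℝ}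
    (h : ∑ i, T i * star (T i) ≤ c • (1 : L)) (hc : 0 ≤ c) (k : ℕ) :
    ∑ p ∈ multiIdx n k, multiCoef p • (symMono T p * star (symMono T p)) ≤ c ^ k • (1 : L) := by
  refine le_trans ?_ (sum_wordProd_mul_star_le h hc k)
  rw [← sum_multiIdx_sum_wordFin]
  refine Finset.sum_le_sum fun p _ => ?_
  refine le_trans (le_of_eq ?_) (sum_mul_star_sum_le (wordFin p) (wordProd T))
  have hp := (multiCoef_pos p).ne'
  rw [card_wordFin, symMono, star_smul, star_trivial, smul_mul_assoc, mul_smul_comm, smul_smul,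
    smul_smul, mul_inv_cancel₀ hp, one_mul]

theorem sum_symMono_mul_star_le_one {n : ℕ} {T : Fin n → L} (h : ∑ i, T i * star (T i) ≤ 1)
    (k : ℕ) :
    ∑ p ∈ multiIdx n k, multiCoef p • (symMono T p * star (symMono T p)) ≤ 1 := by
  simpa using sum_symMono_mul_star_le (c := 1) (by simpa using h) zero_le_one k

theorem sum_tuplePow_mul_star_le_one {n : ℕ} {T : Fin n → L} (hT : ∀ i j, Commute (T i) (T j))
    (h : ∑ i, T i * star (T i) ≤ 1) (k : ℕ) :
    ∑ p ∈ multiIdx n k, multiCoef p • (tuplePow T p * star (tuplePow T p)) ≤ 1 := by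
  simpa only [symMono_eq_tuplePow hT] using sum_symMono_mul_star_le_one h k

theorem sum_tuplePow_mul_star_le {n : ℕ} {T : Fin n → L} (hT : ∀ i j, Commute (T i) (T j)) {c : ℝ}
    (h : ∑ i, T i * star (T i) ≤ c • (1 : L)) (hc : 0 ≤ c) (k : ℕ) :
    ∑ p ∈ multiIdx n k, multiCoef p • (tuplePow T p * star (tuplePow T p)) ≤ c ^ k • (1 : L) := by
  simpa only [symMono_eq_tuplePow hT] using sum_symMono_mul_star_le h hc k

theorem sum_star_tuplePow_mul_le {n : ℕ} {T : Fin n → L} (hT : ∀ i j, Commute (T i) (T j)) {c : ℝ}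
    (h : ∑ i, star (T i) * T i ≤ c • (1 : L)) (hc : 0 ≤ c) (k : ℕ) :
    ∑ p ∈ multiIdx n k, multiCoef p • (star (tuplePow T p) * tuplePow T p) ≤ c ^ k • (1 : L) := by
  have := sum_tuplePow_mul_star_le (T := fun i => star (T i)) (fun i j => (hT i j).star_star)
    (by simpa using h) hc k
  simp only [← star_tuplePow hT, star_star] at this
  exact this

theorem norm_le_of_le_smul_one {a : L} (ha : 0 ≤ a) {c : ℝ} (h : a ≤ c • (1 : L)) (hc : 0 ≤ c) :
    ‖a‖ ≤ c := by
  rw [CStarAlgebra.norm_le_iff_le_algebraMap a hc ha, Algebra.algebraMap_eq_smul_one]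
  exact h

theorem le_norm_smul_one {a : L} (ha : IsSelfAdjoint a) : a ≤ ‖a‖ • (1 : L) := by
  rw [← Algebra.algebraMap_eq_smul_one]
  exact ha.le_algebraMap_norm_self

/-- The product of a weighted row and a weighted column. -/
theorem norm_sum_mul_le_of_weights {ι : Type*} (s : Finset ι) (w : ι → ℝ) (hw : ∀ i, 0 < w i)
    (a b : ι → L) {c : ℝ} (hc : 0 ≤ c)
    (h : ∑ i ∈ s, w i • (a i * star (a i)) ≤ c ^ 2 • (1 : L)) :
    ‖∑ i ∈ s, a i * b i‖ ≤ c * √‖∑ i ∈ s, (w i)⁻¹ • (star (b i) * b i)‖ := by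
  have hs : ∀ i, √(w i) ≠ 0 := fun i => (Real.sqrt_pos.2 (hw i)).ne'
  have h1 := norm_sum_mul_le_row_mul_col s (fun i => √(w i) • a i) (fun i => (√(w i))⁻¹ • b i)
  simp only [star_smul, star_trivial, smul_mul_assoc, mul_smul_comm, smul_smul,
    inv_mul_cancel₀ (hs _), one_smul, ← mul_inv,
    Real.mul_self_sqrt (hw _).le] at h1
  refine h1.trans (mul_le_mul_of_nonneg_right ?_ (Real.sqrt_nonneg _))
  refine Real.sqrt_le_left hc |>.2 ?_ |> fun h => h
  exact norm_le_of_le_smul_one (Finset.sum_nonneg fun i _ =>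
    smul_nonneg (hw i).le (mul_star_self_nonneg _)) h (by positivity)

theorem star_mul_self_le_one {g : L} (hg : ‖g‖ ≤ 1) : star g * g ≤ 1 := by
  refine (le_norm_smul_one (IsSelfAdjoint.star_mul_self g)).trans ?_
  have h : ‖star g * g‖ ≤ 1 := by
    rw [CStarRing.norm_star_mul_self]
    exact mul_le_one₀ hg (norm_nonneg _) hg
  simpa using smul_le_smul_of_nonneg_right h (zero_le_one' L)

/-- If `a, d ≥ 0` have a sum bounded by `c`, then `√a y √a + √d g √d` is bounded by `c` for
contractions `y`, `g`. -/
theorem norm_add_conj_le {q s y g : L} {c : ℝ} (hc : 0 ≤ c)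
    (hq : IsSelfAdjoint q) (hs : IsSelfAdjoint s) (hqs : q * q + s * s ≤ c • (1 : L))
    (hy : ‖y‖ ≤ 1) (hg : ‖g‖ ≤ 1) : ‖q * (y * q) + s * (g * s)‖ ≤ c := by
  -- The sum is the row `[q, s]` times the column `[y q, g s]`; each has norm at most `√c`.
  have h := norm_sum_mul_le_row_mul_col (Finset.univ : Finset (Fin 2)) ![q, s] ![y * q, g * s]
  simp only [Fin.sum_univ_two, Matrix.cons_val_zero, Matrix.cons_val_one, hq.star_eq,
    hs.star_eq, star_mul] at h
  have h1 : ‖q * q + s * s‖ ≤ c := norm_le_of_le_smul_one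
    (add_nonneg hq.mul_self_nonneg hs.mul_self_nonneg) hqs hc
  have conj : ∀ {t u : L}, IsSelfAdjoint t → ‖u‖ ≤ 1 → t * star u * (u * t) ≤ t * t := by
    intro t u ht hu
    simpa [mul_assoc] using ht.conjugate_le_conjugate (star_mul_self_le_one hu)
  have h2 : ‖q * star y * (y * q) + s * star g * (g * s)‖ ≤ c := by
    refine norm_le_of_le_smul_one (add_nonneg ?_ ?_)
      ((add_le_add (conj hq hy) (conj hs hg)).trans hqs) hc
    · simpa [hq.star_eq] using star_mul_self_nonneg (y * q)
    · simpa [hs.star_eq] using star_mul_self_nonneg (g * s)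
  calc _ ≤ _ := h
    _ ≤ √c * √c := by gcongr
    _ = c := Real.mul_self_sqrt hc

/-- A strictly positive element has a strictly positive square root with a selfadjoint inverse. -/
theorem exists_sqrt_inv {d : L} (hd : 0 ≤ d) {ε : ℝ} (hε : 0 < ε) :
    ∃ s r : L, IsSelfAdjoint s ∧ IsSelfAdjoint r ∧ s * s = d + ε • (1 : L) ∧ s * r = 1 ∧
      r * s = 1 := by
  have h1 : IsStrictlyPositive (d + ε • (1 : L)) := by
    have hu : IsUnit (ε • (1 : L)) := (isUnit_one).smul (Units.mk0 ε hε.ne')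
    exact (hu.isStrictlyPositive (smul_nonneg hε.le zero_le_one)).nonneg_add hd
  have h2 : IsUnit (CFC.sqrt (d + ε • (1 : L))) := CFC.isUnit_sqrt_iff_isStrictlyPositive.2 h1
  obtain ⟨u, hu⟩ := h2
  have hs : IsSelfAdjoint (u : L) := by
    rw [hu]; exact (CFC.sqrt_nonneg _).isSelfAdjoint
  refine ⟨u, (u⁻¹ : Lˣ), hs, ?_, ?_, u.mul_inv, u.inv_mul⟩
  · have hu' : star u = u := Units.ext hs
    rw [IsSelfAdjoint, ← Units.coe_star, star_inv, hu']
  · rw [hu]; exact CFC.sqrt_mul_sqrt_self _ h1.nonneg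

end CStar

theorem starAlgHom_map_real_smul {M L : Type*} [CStarAlgebra M] [CStarAlgebra L] (π : M →⋆ₐ[ℂ] L)
    (c : ℝ) (a : M) : π (c • a) = c • π a := by
  rw [← Complex.coe_smul, map_smul, Complex.coe_smul]

/-! ### The Bohr-type estimate in a C⋆-algebra -/

section Bohr

variable {M L : Type*} [CStarAlgebra M] [PartialOrder M] [StarOrderedRing M]
  [CStarAlgebra L] [PartialOrder L] [StarOrderedRing L]

/-- The family of operator inequalities satisfied by the coefficients of a symmetrized power series
whose real part is at most `1`. -/
def CoeffBound {n : ℕ} (A : (Fin n → ℕ) → M) : Prop :=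
  ∀ (r : M) (c : ℝ), IsSelfAdjoint r → 0 < c → r * (1 - A 0) * r ≤ c • (1 : M) →
    ∀ k, 1 ≤ k → ∑ p ∈ multiIdx n k, (multiCoef p)⁻¹ •
      (star (r * A p * r) * (r * A p * r)) ≤ (2 * c) ^ 2 • (1 : M)

/-- The row `x` is a contraction for the weights `multiCoef p`, so what remains is the column `π (e
p) * y p` with the inverse weights. Each of its terms is bounded separately, which suffices because
`multiCoef p ≥ 1`. -/
theorem norm_sum_map_le {n k : ℕ} (π : M →⋆ₐ[ℂ] L) {e : (Fin n → ℕ) → M} {x y : (Fin n → ℕ) → L}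
    (hx : ∑ p ∈ multiIdx n k, multiCoef p • (x p * star (x p)) ≤ 1) {c : ℝ} (hc : 0 ≤ c)
    (he : ∑ p ∈ multiIdx n k, (multiCoef p)⁻¹ • (star (e p) * e p) ≤ c ^ 2 • (1 : M)) :
    ‖∑ p ∈ multiIdx n k, x p * π (e p) * y p‖ ≤
      c * √‖∑ p ∈ multiIdx n k, multiCoef p • (star (y p) * y p)‖ := by
  have h1 := norm_sum_mul_le_of_weights (multiIdx n k) multiCoef multiCoef_pos x
    (fun p => π (e p) * y p) zero_le_one (by simpa using hx)
  simp only [← mul_assoc, one_mul, star_mul] at h1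
  refine h1.trans ?_
  have hy0 : ∀ p : Fin n → ℕ, 0 ≤ multiCoef p • (star (y p) * y p) := fun p =>
    smul_nonneg (multiCoef_pos p).le (star_mul_self_nonneg _)
  have hsum := Finset.sum_nonneg fun p (_ : p ∈ multiIdx n k) => hy0 p
  have h2 : ∑ p ∈ multiIdx n k, (multiCoef p)⁻¹ • (star (y p) * star (π (e p)) * π (e p) * y p) ≤
      c ^ 2 • ∑ p ∈ multiIdx n k, multiCoef p • (star (y p) * y p) := by
    rw [Finset.smul_sum]
    refine Finset.sum_le_sum fun p hp => ?_
    have h3 : (multiCoef p)⁻¹ • (star (e p) * e p) ≤ c ^ 2 • (1 : M) :=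
      (Finset.single_le_sum (f := fun p => (multiCoef p)⁻¹ • (star (e p) * e p))
        (fun q _ => smul_nonneg (inv_nonneg.2 (multiCoef_pos q).le)
        (star_mul_self_nonneg _)) hp).trans he
    have h4 : (multiCoef p)⁻¹ • (star (π (e p)) * π (e p)) ≤ c ^ 2 • (1 : L) := by
      have := OrderHomClass.mono π h3
      simpa [starAlgHom_map_real_smul, map_star] using this
    have h5 := star_left_conjugate_le_conjugate h4 (y p)
    simp only [mul_smul_comm, smul_mul_assoc, mul_one, ← mul_assoc] at h5
    refine h5.trans (smul_le_smul_of_nonneg_left ?_ (by positivity))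
    simpa using smul_le_smul_of_nonneg_right (one_le_multiCoef p) (star_mul_self_nonneg (y p))
  have h6 := CStarAlgebra.norm_le_norm_of_nonneg_of_le (Finset.sum_nonneg fun p _ => ?_) h2
  · rw [norm_smul, Real.norm_of_nonneg (by positivity)] at h6
    calc _ ≤ √(c ^ 2 * ‖∑ p ∈ multiIdx n k, multiCoef p • (star (y p) * y p)‖) :=
          Real.sqrt_le_sqrt h6
      _ = _ := by rw [Real.sqrt_mul (by positivity), Real.sqrt_sq hc]
  · refine smul_nonneg (inv_nonneg.2 (multiCoef_pos p).le) ?_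
    simpa [mul_assoc] using star_mul_self_nonneg (π (e p) * y p)

/-- The common source of (iii) and (iv). Commutation with the range of `π` lets the square roots of
`A 0` and `1 - A 0 + ε` be pulled out of the series on both sides. -/
theorem norm_tsum_map_le_one {n : ℕ} (π : M →⋆ₐ[ℂ] L) {A : (Fin n → ℕ) → M}
    (hA0 : 0 ≤ A 0) (hA1 : A 0 ≤ 1) (hA : CoeffBound A) {x y : (Fin n → ℕ) → L}
    (hx0 : x 0 = 1) (hx : ∀ k, ∑ p ∈ multiIdx n k, multiCoef p • (x p * star (x p)) ≤ 1)
    (hxc : ∀ p a, Commute (x p) (π a)) (hyc : ∀ p a, Commute (y p) (π a)) (hy0 : ‖y 0‖ ≤ 1)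
    (hys : Summable fun k : ℕ => √‖∑ p ∈ multiIdx n (k + 1), multiCoef p • (star (y p) * y p)‖)
    (hy : ∑' k : ℕ, √‖∑ p ∈ multiIdx n (k + 1), multiCoef p • (star (y p) * y p)‖ ≤ 1 / 2) :
    Summable (fun k : ℕ => ∑ p ∈ multiIdx n k, x p * π (A p) * y p) ∧
      ‖∑' k : ℕ, ∑ p ∈ multiIdx n k, x p * π (A p) * y p‖ ≤ 1 := by
  have bound : ∀ r : M, IsSelfAdjoint r → r * (1 - A 0) * r ≤ 1 → ∀ k : ℕ,
      ‖∑ p ∈ multiIdx n (k + 1), x p * π (r * A p * r) * y p‖ ≤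
        2 * √‖∑ p ∈ multiIdx n (k + 1), multiCoef p • (star (y p) * y p)‖ := by
    intro r hr h k
    refine norm_sum_map_le π (hx _) zero_le_two ?_
    simpa using hA r 1 hr one_pos (by simpa using h) (k + 1) (by omega)
  have hs1 : Summable fun k : ℕ => ∑ p ∈ multiIdx n (k + 1), x p * π (A p) * y p := by
    refine Summable.of_norm_bounded (hys.mul_left 2) fun k => ?_
    simpa using bound 1 (IsSelfAdjoint.one M) (by simpa using hA0) k
  have hs : Summable fun k : ℕ => ∑ p ∈ multiIdx n k, x p * π (A p) * y p :=
    (summable_nat_add_iff 1).1 hs1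
  refine ⟨hs, le_of_forall_pos_le_add fun ε hε => ?_⟩
  -- The element `1 - A 0` need not be invertible, so it is shifted by `ε`; `r` is the inverse of `s
  -- = (1 - A 0 + ε)^{1/2}`.
  obtain ⟨s, r, hsa, hra, hss, hsr, hrs⟩ := exists_sqrt_inv (sub_nonneg.2 hA1) hε
  have hr : r * (1 - A 0) * r ≤ 1 := by
    have h1 : (1 - A 0) ≤ s * s := by
      rw [hss]; exact le_add_of_nonneg_right (smul_nonneg hε.le zero_le_one)
    refine (hra.conjugate_le_conjugate h1).trans (le_of_eq ?_)
    rw [← mul_assoc, hrs, one_mul, hsr]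
  set g : ℕ → L := fun k => ∑ p ∈ multiIdx n (k + 1), x p * π (r * A p * r) * y p with hg
  have hgn : Summable fun k => ‖g k‖ :=
    Summable.of_nonneg_of_le (fun _ => norm_nonneg _) (bound r hra hr) (hys.mul_left 2)
  have hgs : Summable g := hgn.of_norm
  -- The factor `2` of the coefficient bound meets the budget `1/2` of the column norms of `y`.
  have hG : ‖∑' k, g k‖ ≤ 1 := by
    refine (norm_tsum_le_tsum_norm hgn).trans ((hgn.tsum_le_tsum (bound r hra hr)
      (hys.mul_left 2)).trans ?_)
    rw [tsum_mul_left]; linarith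
  have hterm : ∀ k, ∑ p ∈ multiIdx n (k + 1), x p * π (A p) * y p = π s * g k * π s := by
    intro k
    rw [hg, Finset.mul_sum, Finset.sum_mul]
    refine Finset.sum_congr rfl fun p _ => ?_
    have e : A p = s * (r * A p * r) * s := by
      simp only [← mul_assoc, hsr, one_mul]
      rw [mul_assoc, hrs, mul_one]
    conv_lhs => rw [e, map_mul, map_mul]
    rw [← mul_assoc, ← mul_assoc, (hxc p s).eq, mul_assoc _ (π s) (y p), ← (hyc p s).eq]
    simp only [mul_assoc]
  have hq : 0 ≤ CFC.sqrt (A 0) := CFC.sqrt_nonneg _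
  have hsum : ∑' k : ℕ, ∑ p ∈ multiIdx n k, x p * π (A p) * y p =
      π (CFC.sqrt (A 0)) * (y 0 * π (CFC.sqrt (A 0))) + π s * ((∑' k, g k) * π s) := by
    rw [hs.tsum_eq_zero_add, multiIdx_zero, Finset.sum_singleton, hx0, one_mul]
    congr 1
    · rw [(hyc 0 _).eq, ← mul_assoc, ← map_mul, CFC.sqrt_mul_sqrt_self _ hA0]
    · simp only [hterm]
      rw [hgs.mul_left (π s) |>.tsum_mul_right, hgs.tsum_mul_left, mul_assoc]
  rw [hsum]
  refine norm_add_conj_le (by positivity) (hq.isSelfAdjoint.map π) (hsa.map π) ?_ hy0 hG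
  -- The two squares add up to `A 0 + (1 - A 0 + ε) = 1 + ε`.
  rw [← map_mul, ← map_mul, ← map_add, CFC.sqrt_mul_sqrt_self _ hA0, hss]
  refine le_of_eq ?_
  simp [add_smul, starAlgHom_map_real_smul, ← add_assoc]

end Bohr

/-! ### Operators on Hilbert space tensor products -/

section TensorOps

variable {E F : Type*} [NormedAddCommGroup E] [InnerProductSpace ℂ E]
  [NormedAddCommGroup F] [InnerProductSpace ℂ F]

/-- The elementary tensor `x ⊗ y` in the Hilbert space tensor product. -/
def pureTensor (x : E) (y : F) : HTensor E F :=
  ((x ⊗ₜ[ℂ] y : E ⊗[ℂ] F) : UniformSpace.Completion (E ⊗[ℂ] F))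

theorem inner_pureTensor (x x' : E) (y y' : F) :
    inner ℂ (pureTensor x y) (pureTensor x' y') = inner ℂ x x' * inner ℂ y y' := by
  refine (UniformSpace.Completion.inner_coe _ _).trans ?_
  rw [TensorProduct.inner_tmul]

theorem opTensor_pureTensor (T : E →L[ℂ] E) (A : F →L[ℂ] F) (x : E) (y : F) :
    opTensor T A (pureTensor x y) = pureTensor (T x) (A y) :=
  (TensorProduct.mapL T A).completion_apply_coe _

theorem dense_span_pureTensor :
    Dense (Submodule.span ℂ (Set.range fun z : E × F => pureTensor z.1 z.2) :
      Set (HTensor E F)) := by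
  refine Dense.mono ?_ (UniformSpace.Completion.denseRange_coe (α := E ⊗[ℂ] F))
  rintro _ ⟨t, rfl⟩
  induction t using TensorProduct.induction_on with
  | zero => exact Submodule.zero_mem _
  | tmul x y => exact Submodule.subset_span ⟨(x, y), rfl⟩
  | add s t hs ht =>
    rw [UniformSpace.Completion.coe_add]
    exact Submodule.add_mem _ hs ht

theorem ext_pureTensor {G : Type*} [NormedAddCommGroup G] [NormedSpace ℂ G]
    {f g : HTensor E F →L[ℂ] G} (h : ∀ x y, f (pureTensor x y) = g (pureTensor x y)) : f = g := by
  refine ContinuousLinearMap.ext_on dense_span_pureTensor ?_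
  rintro _ ⟨z, rfl⟩
  exact h _ _

theorem pureTensor_add_left (x x' : E) (y : F) :
    pureTensor (x + x') y = pureTensor x y + pureTensor x' y := by
  simp only [pureTensor, TensorProduct.add_tmul]
  exact UniformSpace.Completion.coe_add _ _

theorem pureTensor_add_right (x : E) (y y' : F) :
    pureTensor x (y + y') = pureTensor x y + pureTensor x y' := by
  simp only [pureTensor, TensorProduct.tmul_add]
  exact UniformSpace.Completion.coe_add _ _

theorem pureTensor_smul_left (c : ℂ) (x : E) (y : F) :
    pureTensor (c • x) y = c • pureTensor x y := by
  simp only [pureTensor, ← TensorProduct.smul_tmul']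
  exact UniformSpace.Completion.coe_smul c (x ⊗ₜ[ℂ] y)

theorem pureTensor_smul_right (c : ℂ) (x : E) (y : F) :
    pureTensor x (c • y) = c • pureTensor x y := by
  simp only [pureTensor, TensorProduct.tmul_smul]
  exact UniformSpace.Completion.coe_smul c (x ⊗ₜ[ℂ] y)

theorem opTensor_mul (T T' : E →L[ℂ] E) (A A' : F →L[ℂ] F) :
    opTensor (T * T') (A * A') = opTensor T A * opTensor T' A' :=
  ext_pureTensor fun x y => by simp [opTensor_pureTensor]

theorem opTensor_one : opTensor (1 : E →L[ℂ] E) (1 : F →L[ℂ] F) = 1 :=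
  ext_pureTensor fun x y => by simp [opTensor_pureTensor]

theorem opTensor_add_left (T T' : E →L[ℂ] E) (A : F →L[ℂ] F) :
    opTensor (T + T') A = opTensor T A + opTensor T' A :=
  ext_pureTensor fun x y => by simp [opTensor_pureTensor, pureTensor_add_left]

theorem opTensor_add_right (T : E →L[ℂ] E) (A A' : F →L[ℂ] F) :
    opTensor T (A + A') = opTensor T A + opTensor T A' :=
  ext_pureTensor fun x y => by simp [opTensor_pureTensor, pureTensor_add_right]

theorem opTensor_smul_left (c : ℂ) (T : E →L[ℂ] E) (A : F →L[ℂ] F) :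
    opTensor (c • T) A = c • opTensor T A :=
  ext_pureTensor fun x y => by simp [opTensor_pureTensor, pureTensor_smul_left]

theorem opTensor_smul_right (c : ℂ) (T : E →L[ℂ] E) (A : F →L[ℂ] F) :
    opTensor T (c • A) = c • opTensor T A :=
  ext_pureTensor fun x y => by simp [opTensor_pureTensor, pureTensor_smul_right]

theorem star_opTensor [CompleteSpace E] [CompleteSpace F] (T : E →L[ℂ] E) (A : F →L[ℂ] F) :
    star (opTensor T A) = opTensor (star T) (star A) := by
  refine ext_pureTensor fun x y => ?_
  refine ext_inner_right ℂ fun v => ?_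
  have h : innerSL ℂ (pureTensor x y) ∘L opTensor T A =
      innerSL ℂ (opTensor (star T) (star A) (pureTensor x y)) := by
    refine ext_pureTensor fun x' y' => ?_
    simp only [ContinuousLinearMap.comp_apply, innerSL_apply_apply, opTensor_pureTensor,
      inner_pureTensor, ContinuousLinearMap.star_eq_adjoint, ContinuousLinearMap.adjoint_inner_left]
  have h' := DFunLike.congr_fun h v
  rw [ContinuousLinearMap.star_eq_adjoint, ContinuousLinearMap.adjoint_inner_left]
  simpa using h'

variable [CompleteSpace E] [CompleteSpace F]

/-- The representation `T ↦ T ⊗ I`. -/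
def leftTensor (E F : Type*) [NormedAddCommGroup E] [InnerProductSpace ℂ E]
    [NormedAddCommGroup F] [InnerProductSpace ℂ F] [CompleteSpace E] [CompleteSpace F] :
    (E →L[ℂ] E) →⋆ₐ[ℂ] (HTensor E F →L[ℂ] HTensor E F) where
  toFun T := opTensor T 1
  map_one' := opTensor_one
  map_mul' T T' := by rw [← opTensor_mul, mul_one]
  map_zero' := by simpa using opTensor_smul_left (0 : ℂ) (0 : E →L[ℂ] E) (1 : F →L[ℂ] F)
  map_add' T T' := opTensor_add_left T T' 1
  commutes' c := by
    rw [Algebra.algebraMap_eq_smul_one, Algebra.algebraMap_eq_smul_one, opTensor_smul_left,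
      opTensor_one]
  map_star' T := by rw [star_opTensor, star_one]

/-- The representation `A ↦ I ⊗ A`. -/
def rightTensor (E F : Type*) [NormedAddCommGroup E] [InnerProductSpace ℂ E]
    [NormedAddCommGroup F] [InnerProductSpace ℂ F] [CompleteSpace E] [CompleteSpace F] :
    (F →L[ℂ] F) →⋆ₐ[ℂ] (HTensor E F →L[ℂ] HTensor E F) where
  toFun A := opTensor 1 A
  map_one' := opTensor_one
  map_mul' A A' := by rw [← opTensor_mul, mul_one]
  map_zero' := by simpa using opTensor_smul_right (0 : ℂ) (1 : E →L[ℂ] E) (0 : F →L[ℂ] F)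
  map_add' A A' := opTensor_add_right 1 A A'
  commutes' c := by
    rw [Algebra.algebraMap_eq_smul_one, Algebra.algebraMap_eq_smul_one, opTensor_smul_right,
      opTensor_one]
  map_star' A := by rw [star_opTensor, star_one]

/-- Splits tensor products into commuting representations, so that the C⋆-algebra estimates apply.
-/
theorem opTensor_eq_left_mul_right (T : E →L[ℂ] E) (A : F →L[ℂ] F) :
    opTensor T A = leftTensor E F T * rightTensor E F A := by
  change _ = opTensor T 1 * opTensor 1 A
  rw [← opTensor_mul, mul_one, one_mul]

theorem commute_left_right (T : E →L[ℂ] E) (A : F →L[ℂ] F) :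
    Commute (leftTensor E F T) (rightTensor E F A) := by
  change opTensor T 1 * opTensor 1 A = opTensor 1 A * opTensor T 1
  simp only [← opTensor_mul, mul_one, one_mul]

end TensorOps

/-! ### Operator inequalities on vectors -/

section Vectors

theorem isSelfAdjoint_real_smul {L : Type*} [CStarAlgebra L] {a : L} (ha : IsSelfAdjoint a)
    (c : ℝ) : IsSelfAdjoint (c • a) :=
  (IsSelfAdjoint.all c).smul ha

theorem re_inner_smul_one {H : Type*} [NormedAddCommGroup H] [InnerProductSpace ℂ H] (c : ℝ) (x : H) :
    (inner ℂ x ((c • (1 : H →L[ℂ] H)) x)).re = c * ‖x‖ ^ 2 := by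
  have h := congrArg Complex.re (inner_self_eq_norm_sq_to_K (𝕜 := ℂ) x)
  have e : (c • (1 : H →L[ℂ] H)) x = (c : ℂ) • x := rfl
  rw [e, inner_smul_right, Complex.re_ofReal_mul]
  congr 1
  exact_mod_cast h

variable {H : Type*} [NormedAddCommGroup H] [InnerProductSpace ℂ H] [CompleteSpace H]

theorem clm_le_iff {S T : H →L[ℂ] H} (hS : IsSelfAdjoint S) (hT : IsSelfAdjoint T) :
    S ≤ T ↔ ∀ x, (inner ℂ x (S x)).re ≤ (inner ℂ x (T x)).re := by
  rw [ContinuousLinearMap.le_def, ContinuousLinearMap.isPositive_def']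
  simp only [hT.sub hS, true_and, ContinuousLinearMap.reApplyInnerSelf_apply]
  refine forall_congr' fun x => ?_
  simp only [sub_apply, inner_sub_left, map_sub, sub_nonneg]
  rw [inner_re_symm, inner_re_symm (𝕜 := ℂ) (T x)]
  rfl

theorem re_inner_star_mul_self (T : H →L[ℂ] H) (x : H) :
    (inner ℂ x ((star T * T) x)).re = ‖T x‖ ^ 2 := by
  rw [mul_apply_eq_comp, ContinuousLinearMap.star_eq_adjoint,
    ContinuousLinearMap.adjoint_inner_right]
  exact_mod_cast congrArg Complex.re (inner_self_eq_norm_sq_to_K (𝕜 := ℂ) (T x))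

theorem sum_smul_star_mul_self_le_iff {ι : Type*} (s : Finset ι) (w : ι → ℝ) (b : ι → H →L[ℂ] H)
    (c : ℝ) : ∑ i ∈ s, w i • (star (b i) * b i) ≤ c • (1 : H →L[ℂ] H) ↔
      ∀ x, ∑ i ∈ s, w i * ‖b i x‖ ^ 2 ≤ c * ‖x‖ ^ 2 := by
  have h1 : IsSelfAdjoint (∑ i ∈ s, w i • (star (b i) * b i)) := by
    refine isSelfAdjoint_sum _ fun i _ => ?_
    exact isSelfAdjoint_real_smul (IsSelfAdjoint.star_mul_self (b i)) (w i)
  have h2 : IsSelfAdjoint (c • (1 : H →L[ℂ] H)) :=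
    isSelfAdjoint_real_smul (IsSelfAdjoint.one _) c
  rw [clm_le_iff h1 h2]
  refine forall_congr' fun x => ?_
  rw [re_inner_smul_one, sum_apply, inner_sum, Complex.re_sum]
  have e : ∀ i, (inner ℂ x ((w i • (star (b i) * b i)) x)).re = w i * ‖b i x‖ ^ 2 := by
    intro i
    rw [← re_inner_star_mul_self]
    have e : (w i • (star (b i) * b i)) x = (w i : ℂ) • (star (b i) * b i) x := rfl
    rw [e, inner_smul_right, Complex.re_ofReal_mul]
  simp only [e]

theorem sum_star_mul_self_le_iff {ι : Type*} (s : Finset ι) (b : ι → H →L[ℂ] H)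
    (c : ℝ) : ∑ i ∈ s, star (b i) * b i ≤ c • (1 : H →L[ℂ] H) ↔
      ∀ x, ∑ i ∈ s, ‖b i x‖ ^ 2 ≤ c * ‖x‖ ^ 2 := by
  simpa using sum_smul_star_mul_self_le_iff s (fun _ => 1) b c

theorem sum_star_mul_self_le_one_iff {ι : Type*} (s : Finset ι) (b : ι → H →L[ℂ] H) :
    ∑ i ∈ s, star (b i) * b i ≤ (1 : H →L[ℂ] H) ↔ ∀ x, ∑ i ∈ s, ‖b i x‖ ^ 2 ≤ ‖x‖ ^ 2 := by
  simpa using sum_star_mul_self_le_iff s b 1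

/-- The adjoint of the row of the `star (Y i)` is the column of the `Y i`. Concretely, the row is
evaluated at `v = (Y i x)_i`, where its inner product with `x` is `‖v‖ ^ 2`. -/
theorem sum_norm_sq_le_of_norm_rowOp_star_le {n : ℕ} {Y : Fin n → H →L[ℂ] H} {c : ℝ} (hc : 0 ≤ c)
    (h : ‖rowOp fun i => star (Y i)‖ ≤ c) (x : H) : ∑ i, ‖Y i x‖ ^ 2 ≤ c ^ 2 * ‖x‖ ^ 2 := by
  set v : PiLp 2 (fun _ : Fin n => H) := WithLp.toLp 2 fun i => Y i x with hv
  have hvn : ‖v‖ ^ 2 = ∑ i, ‖Y i x‖ ^ 2 := PiLp.norm_sq_eq_of_L2 _ v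
  have h1 : (inner ℂ x (rowOp (fun i => star (Y i)) v)).re = ‖v‖ ^ 2 := by
    rw [hvn, rowOp, sum_apply, inner_sum, Complex.re_sum]
    exact Finset.sum_congr rfl fun i _ => re_inner_star_mul_self (Y i) x
  have h2 : ‖v‖ ^ 2 ≤ ‖x‖ * (c * ‖v‖) := by
    rw [← h1]
    refine (Complex.re_le_norm _).trans ((norm_inner_le_norm _ _).trans ?_)
    gcongr
    exact ((rowOp fun i => star (Y i)).le_opNorm v).trans (by gcongr)
  have h3 : ‖v‖ ≤ c * ‖x‖ := by
    rcases (norm_nonneg v).eq_or_lt with h0 | h0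
    · rw [← h0]; positivity
    · nlinarith
  rw [← hvn, ← mul_pow]
  gcongr

end Vectors

/-! ### Creation operators -/

section Creation

variable {n : ℕ}

theorem leftCreation_apply_of_mul (i : Fin n) (u : Fock n) (β : FreeMonoid (Fin n)) :
    leftCreation i u (FreeMonoid.of i * β) = u β :=
  shiftFun_of_mul i _ β

theorem leftCreation_apply_of_mul_ne {i j : Fin n} (h : i ≠ j) (u : Fock n)
    (β : FreeMonoid (Fin n)) : leftCreation i u (FreeMonoid.of j * β) = 0 := by
  refine shiftFun_of_not_exists ?_
  rintro ⟨γ, hγ⟩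
  exact h (List.cons.inj hγ).1

theorem leftCreation_apply_one (i : Fin n) (u : Fock n) : leftCreation i u 1 = 0 := by
  refine shiftFun_of_not_exists ?_
  rintro ⟨γ, hγ⟩
  exact List.cons_ne_nil _ _ hγ

/-- The basis vector `e_α` of the full Fock space. -/
def fockBasis (α : FreeMonoid (Fin n)) : Fock n := lp.single 2 α (1 : ℂ)

theorem inner_fockBasis_left (α : FreeMonoid (Fin n)) (u : Fock n) :
    inner ℂ (fockBasis α) u = u α := by
  rw [fockBasis, lp.inner_single_left, RCLike.inner_apply]; simp

theorem inner_fockBasis (α β : FreeMonoid (Fin n)) :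
    inner ℂ (fockBasis α) (fockBasis β) = if α = β then (1 : ℂ) else 0 := by
  rw [inner_fockBasis_left, fockBasis, lp.coeFn_single, Pi.single_apply]

theorem leftCreation_fockBasis (i : Fin n) (β : FreeMonoid (Fin n)) :
    leftCreation i (fockBasis β) = fockBasis (FreeMonoid.of i * β) := by
  ext α
  induction α using FreeMonoid.inductionOn' with
  | one =>
    rw [leftCreation_apply_one, ← inner_fockBasis_left, inner_fockBasis, if_neg]
    exact fun h => List.cons_ne_nil _ _ h.symm
  | of_mul j γ _ =>
    rcases eq_or_ne i j with rfl | hij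
    · rw [leftCreation_apply_of_mul, ← inner_fockBasis_left, inner_fockBasis,
        ← inner_fockBasis_left, inner_fockBasis]
      simp only [mul_right_inj]
    · rw [leftCreation_apply_of_mul_ne hij, ← inner_fockBasis_left, inner_fockBasis, if_neg]
      exact fun h => hij (List.cons.inj h).1.symm

theorem wordProd_leftCreation_fockBasis (α β : FreeMonoid (Fin n)) :
    wordProd leftCreation α (fockBasis β) = fockBasis (α * β) := by
  induction α using FreeMonoid.inductionOn' with
  | one => rw [wordProd_one, one_mul]; rfl
  | of_mul i γ ih =>
    rw [wordProd_of_mul, mul_apply_eq_comp, ih, leftCreation_fockBasis, mul_assoc]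

theorem star_leftCreation_apply (i : Fin n) (u : Fock n) (β : FreeMonoid (Fin n)) :
    star (leftCreation i) u β = u (FreeMonoid.of i * β) := by
  rw [← inner_fockBasis_left, ContinuousLinearMap.star_eq_adjoint,
    ContinuousLinearMap.adjoint_inner_right, leftCreation_fockBasis, inner_fockBasis_left]

theorem star_leftCreation_mul (i j : Fin n) :
    star (leftCreation i) * leftCreation j = if i = j then (1 : Fock n →L[ℂ] Fock n) else 0 := by
  ext u β
  rw [mul_apply_eq_comp, star_leftCreation_apply]
  split_ifs with h
  · subst h; exact leftCreation_apply_of_mul _ _ _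
  · exact leftCreation_apply_of_mul_ne (Ne.symm h) _ _

/-- The ranges of the isometries `S_i` are mutually orthogonal, so the sum is an orthogonal
projection. -/
theorem sum_leftCreation_mul_star_le :
    ∑ i : Fin n, leftCreation i * star (leftCreation i) ≤ 1 := by
  set P : Fock n →L[ℂ] Fock n := ∑ i, leftCreation i * star (leftCreation i) with hP
  have h1 : star P = P := by simp [hP, star_sum]
  have h2 : P * P = P := by
    simp only [hP, Finset.sum_mul, Finset.mul_sum]
    refine Finset.sum_congr rfl fun i _ => ?_
    rw [Finset.sum_eq_single i]
    · rw [mul_assoc, ← mul_assoc (star (leftCreation i)), star_leftCreation_mul, if_pos rfl,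
        one_mul]
    · intro j _ hj
      rw [mul_assoc, ← mul_assoc (star (leftCreation _)), star_leftCreation_mul]
      simp [hj]
    · simp
  have h3 := star_mul_self_nonneg (1 - P)
  have e : star (1 - P) * (1 - P) = 1 - P := by
    rw [star_sub, h1, star_one, mul_sub, mul_one, sub_mul, one_mul, h2, sub_self, sub_zero]
  rw [e] at h3
  exact sub_nonneg.1 h3

theorem star_leftCreation_mem_symFock (i : Fin n) {u : Fock n} (hu : u ∈ symFock n) :
    star (leftCreation i) u ∈ symFock n := by
  intro α β hαβ
  rw [star_leftCreation_apply, star_leftCreation_apply]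
  exact hu _ _ (hαβ.cons i)

/-- The adjoints `S_i^*` leave the symmetric space invariant, so `B_i^*` is a plain restriction and
the projection disappears. Properties of the `B_i` are therefore read off from their adjoints. -/
theorem coe_star_symCreation_apply (i : Fin n) (u : symFock n) :
    ((star (symCreation i) u : symFock n) : Fock n) = star (leftCreation i) (u : Fock n) := by
  have h : star (symCreation i) u =
      ⟨star (leftCreation i) (u : Fock n), star_leftCreation_mem_symFock i u.2⟩ := by
    refine ext_inner_right ℂ fun v => ?_
    have h1 : inner ℂ (star (symCreation i) u) v = inner ℂ u (symCreation i v) := by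
      rw [ContinuousLinearMap.star_eq_adjoint, ContinuousLinearMap.adjoint_inner_left]
    have h2 : inner ℂ (star (leftCreation i) (u : Fock n)) (v : Fock n) =
        inner ℂ (u : Fock n) (leftCreation i (v : Fock n)) := by
      rw [ContinuousLinearMap.star_eq_adjoint, ContinuousLinearMap.adjoint_inner_left]
    rw [h1]
    refine Eq.trans ?_ h2.symm
    exact Submodule.inner_orthogonalProjectionOnto_eq_of_mem_left u _
  rw [h]

/-- On adjoints: the two products evaluate a symmetric vector at words differing by a swap of the
first two letters. -/
theorem commute_symCreation (i j : Fin n) :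
    Commute (symCreation i : symFock n →L[ℂ] symFock n) (symCreation j) := by
  have h : Commute (star (symCreation i : symFock n →L[ℂ] symFock n)) (star (symCreation j)) := by
    ext u β
    simp only [mul_apply_eq_comp, coe_star_symCreation_apply, star_leftCreation_apply]
    refine u.2 _ _ ?_
    exact List.Perm.swap _ _ _
  exact commute_star_star.1 h

theorem sum_symCreation_mul_star_le :
    ∑ i : Fin n, (symCreation i : symFock n →L[ℂ] symFock n) * star (symCreation i) ≤ 1 := by
  have h := (sum_star_mul_self_le_one_iff Finset.univ
    (fun i : Fin n => star (symCreation i : symFock n →L[ℂ] symFock n))).2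
  simp only [star_star] at h
  refine h fun u => ?_
  have h' := (sum_star_mul_self_le_one_iff Finset.univ
    (fun i : Fin n => star (leftCreation i))).1
    (by simpa using sum_leftCreation_mul_star_le (n := n)) u
  simpa [← Submodule.coe_norm, ← coe_star_symCreation_apply] using h'

theorem symMonomial_smul_leftCreation (r : ℂ) (p : Fin n → ℕ) :
    symMonomial (fun i => r • leftCreation (n := n) i) p =
      r ^ (∑ i, p i) • symMono leftCreation p := by
  have h : ∀ α : FreeMonoid (Fin n), wordProd (fun i => r • leftCreation (n := n) i) α =
      r ^ α.length • wordProd leftCreation α := by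
    intro α
    induction α using FreeMonoid.inductionOn' with
    | one => simp [wordProd_one]
    | of_mul i β ih =>
      rw [wordProd_of_mul, ih, wordProd_of_mul, FreeMonoid.length_mul, FreeMonoid.length_of,
        smul_mul_smul_comm, pow_add, pow_one]
  have h' : ∑ α ∈ wordFin p, wordProd (fun i => r • leftCreation (n := n) i) α =
      r ^ (∑ i, p i) • ∑ α ∈ wordFin p, wordProd leftCreation α := by
    rw [Finset.smul_sum]
    refine Finset.sum_congr rfl fun α hα => ?_
    rw [h, ← sum_content, mem_wordFin.1 hα]
  change (((multiCoef p)⁻¹ : ℝ) : ℂ) • ∑ α ∈ wordFin p, _ = _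
  rw [h', smul_comm, symMono, Complex.coe_smul]

/-- The sum `∑_{α ∈ Λ_p} e_α`. -/
def classVec (p : Fin n → ℕ) : Fock n := ∑ α ∈ wordFin p, fockBasis α

theorem inner_classVec (p q : Fin n → ℕ) :
    inner ℂ (classVec p) (classVec q) = if p = q then ((multiCoef p : ℝ) : ℂ) else 0 := by
  simp only [classVec, sum_inner, inner_sum, inner_fockBasis, Finset.sum_ite_eq']
  split_ifs with h
  · subst h
    rw [← card_wordFin]
    simp
  · refine Finset.sum_eq_zero fun α hα => if_neg fun hα' => h ?_
    rw [← mem_wordFin.1 hα, mem_wordFin.1 hα']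

theorem symMono_leftCreation_apply (q : Fin n → ℕ) (u : Fock n) :
    symMono leftCreation q u =
      (((multiCoef q)⁻¹ : ℝ) : ℂ) • ∑ α ∈ wordFin q, wordProd leftCreation α u := by
  rw [symMono, ← Complex.coe_smul, smul_apply, sum_apply]

theorem symMono_leftCreation_classVec_zero (q : Fin n → ℕ) :
    symMono leftCreation q (classVec 0) = (((multiCoef q)⁻¹ : ℝ) : ℂ) • classVec q := by
  rw [symMono_leftCreation_apply, classVec, wordFin_zero, Finset.sum_singleton, classVec]
  simp only [wordProd_leftCreation_fockBasis, mul_one]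

/-- Word lengths add under concatenation, so vectors of the wrong degree are orthogonal. -/
theorem inner_classVec_symMono_leftCreation {p p' q : Fin n → ℕ}
    (h : ∑ i, p' i ≠ ∑ i, q i + ∑ i, p i) :
    inner ℂ (classVec p') (symMono leftCreation q (classVec p)) = 0 := by
  rw [symMono_leftCreation_apply, inner_smul_right]
  simp only [classVec, map_sum, wordProd_leftCreation_fockBasis, sum_inner, inner_sum,
    inner_fockBasis]
  refine mul_eq_zero_of_right _ (Finset.sum_eq_zero fun α hα => Finset.sum_eq_zero fun β hβ =>
    Finset.sum_eq_zero fun γ hγ => if_neg fun e => h ?_)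
  rw [← mem_wordFin.1 hα, ← mem_wordFin.1 hβ, ← mem_wordFin.1 hγ, sum_content, sum_content,
    sum_content, e, FreeMonoid.length_mul]

end Creation

/-! ### Coefficients of series with real part at most one -/

section TestVectors

variable {n : ℕ} {H : Type*} [NormedAddCommGroup H] [InnerProductSpace ℂ H]

/-- The vector `∑ (∑_{α ∈ Λ_p} e_α) ⊗ z_p`, the outer sum being over `p = 0` and `|p| = k`. -/
def testVec (k : ℕ) (z : (Fin n → ℕ) → H) : HTensor (Fock n) H :=
  ∑ p ∈ insert 0 (multiIdx n k), pureTensor (classVec p) (z p)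

theorem inner_testVec_opTensor (k : ℕ) (z : (Fin n → ℕ) → H) (T : Fock n →L[ℂ] Fock n)
    (B : H →L[ℂ] H) :
    inner ℂ (testVec k z) (opTensor T B (testVec k z)) =
      ∑ p' ∈ insert 0 (multiIdx n k), ∑ p ∈ insert 0 (multiIdx n k),
        inner ℂ (classVec p') (T (classVec p)) * inner ℂ (z p') (B (z p)) := by
  simp only [testVec, map_sum, sum_inner, inner_sum, opTensor_pureTensor, inner_pureTensor]
  exact Finset.sum_comm

/-- The homogeneous part of degree `k` of the symmetrized series. -/
def homPart (A : (Fin n → ℕ) → H →L[ℂ] H) (k : ℕ) : HTensor (Fock n) H →L[ℂ] HTensor (Fock n) H :=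
  ∑ p ∈ multiIdx n k, opTensor (symMono leftCreation p) (A p)

theorem inner_testVec_opTensor_one (k : ℕ) (z : (Fin n → ℕ) → H) (B : H →L[ℂ] H) :
    inner ℂ (testVec k z) (opTensor 1 B (testVec k z)) =
      ∑ p ∈ insert 0 (multiIdx n k), ((multiCoef p : ℝ) : ℂ) * inner ℂ (z p) (B (z p)) := by
  rw [inner_testVec_opTensor]
  refine Finset.sum_congr rfl fun p hp => ?_
  simp only [one_apply_eq_self, inner_classVec, ite_mul, zero_mul]
  rw [Finset.sum_ite_eq, if_pos hp]

theorem sum_eq_of_mem_insert {k : ℕ} {p : Fin n → ℕ} (hp : p ∈ insert 0 (multiIdx n k)) :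
    (p = 0 ∧ ∑ i, p i = 0) ∨ ∑ i, p i = k := by
  rcases Finset.mem_insert.1 hp with rfl | h
  · simp
  · exact Or.inr (mem_multiIdx.1 h)

theorem inner_testVec_homPart_zero (A : (Fin n → ℕ) → H →L[ℂ] H) (k : ℕ) (z : (Fin n → ℕ) → H) :
    inner ℂ (testVec k z) (homPart A 0 (testVec k z)) =
      ∑ p ∈ insert 0 (multiIdx n k), ((multiCoef p : ℝ) : ℂ) * inner ℂ (z p) (A 0 (z p)) := by
  rw [homPart, multiIdx_zero, Finset.sum_singleton, symMono_zero, inner_testVec_opTensor_one]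

/-- The test vector occupies degrees `0` and `k`, so only shifts by `0` or `k` pair it with itself.
-/
theorem inner_testVec_homPart_of_ne (A : (Fin n → ℕ) → H →L[ℂ] H) {k m : ℕ} (hm : m ≠ 0)
    (hmk : m ≠ k) (z : (Fin n → ℕ) → H) :
    inner ℂ (testVec k z) (homPart A m (testVec k z)) = 0 := by
  rw [homPart, sum_apply, inner_sum]
  refine Finset.sum_eq_zero fun q hq => ?_
  rw [inner_testVec_opTensor]
  refine Finset.sum_eq_zero fun p' hp' => Finset.sum_eq_zero fun p hp => ?_
  rw [inner_classVec_symMono_leftCreation, zero_mul]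
  rw [mem_multiIdx.1 hq]
  rcases sum_eq_of_mem_insert hp' with ⟨-, h'⟩ | h' <;>
    rcases sum_eq_of_mem_insert hp with ⟨-, h⟩ | h <;> omega

/-- Only the passage from the vacuum to degree `k` survives; the factor `p!/|p|!` of the symmetrized
monomial cancels the squared norm of `classVec`. -/
theorem inner_testVec_homPart_self (A : (Fin n → ℕ) → H →L[ℂ] H) {k : ℕ} (hk : k ≠ 0)
    (z : (Fin n → ℕ) → H) :
    inner ℂ (testVec k z) (homPart A k (testVec k z)) =
      ∑ q ∈ multiIdx n k, inner ℂ (z q) (A q (z 0)) := by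
  rw [homPart, sum_apply, inner_sum]
  refine Finset.sum_congr rfl fun q hq => ?_
  rw [inner_testVec_opTensor, Finset.sum_eq_single q]
  · rw [Finset.sum_eq_single 0]
    · rw [symMono_leftCreation_classVec_zero, inner_smul_right, inner_classVec, if_pos rfl,
        ← Complex.ofReal_mul, inv_mul_cancel₀ (multiCoef_pos q).ne', Complex.ofReal_one, one_mul]
    · intro p hp hp0
      rw [inner_classVec_symMono_leftCreation, zero_mul]
      rcases sum_eq_of_mem_insert hp with ⟨h, -⟩ | h
      · exact absurd h hp0
      · rw [mem_multiIdx.1 hq, h]; omega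
    · exact fun h => absurd (Finset.mem_insert_self _ _) h
  · intro p' hp' hne
    refine Finset.sum_eq_zero fun p hp => ?_
    rcases sum_eq_of_mem_insert hp with ⟨rfl, -⟩ | h
    · rw [symMono_leftCreation_classVec_zero, inner_smul_right, inner_classVec, if_neg hne,
        mul_zero, zero_mul]
    · rw [inner_classVec_symMono_leftCreation, zero_mul]
      rw [mem_multiIdx.1 hq, h]
      rcases sum_eq_of_mem_insert hp' with ⟨-, h'⟩ | h' <;> omega
  · exact fun h => absurd (Finset.mem_insert_of_mem hq) h

end TestVectors

/-! ### Convergence of the symmetrized series and the coefficient inequality -/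

section Coefficients

variable {n : ℕ} {H : Type*} [NormedAddCommGroup H] [InnerProductSpace ℂ H] [CompleteSpace H]

/-- The norm of the weighted column of the coefficients of degree `k`. -/
def colNorm (A : (Fin n → ℕ) → H →L[ℂ] H) (k : ℕ) : ℝ :=
  √‖∑ p ∈ multiIdx n k, (multiCoef p)⁻¹ • (star (A p) * A p)‖

theorem norm_sum_opTensor_le {E : Type*} [NormedAddCommGroup E] [InnerProductSpace ℂ E]
    [CompleteSpace E] {k : ℕ} {X : (Fin n → ℕ) → E →L[ℂ] E} {c : ℝ} (hc : 0 ≤ c)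
    (hX : ∑ p ∈ multiIdx n k, multiCoef p • (X p * star (X p)) ≤ c ^ 2 • (1 : E →L[ℂ] E))
    (A : (Fin n → ℕ) → H →L[ℂ] H) :
    ‖∑ p ∈ multiIdx n k, opTensor (X p) (A p)‖ ≤ c * colNorm A k := by
  simp only [opTensor_eq_left_mul_right]
  have hX' : ∑ p ∈ multiIdx n k, multiCoef p •
      (leftTensor E H (X p) * star (leftTensor E H (X p))) ≤
      c ^ 2 • (1 : HTensor E H →L[ℂ] HTensor E H) := by
    have h := OrderHomClass.mono (leftTensor E H) hX
    simpa only [map_sum, starAlgHom_map_real_smul, map_mul, map_star, map_one] using h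
  refine (norm_sum_mul_le_of_weights (multiIdx n k) multiCoef multiCoef_pos _
    (fun p => rightTensor E H (A p)) hc hX').trans ?_
  refine mul_le_mul_of_nonneg_left (Real.sqrt_le_sqrt ?_) hc
  have h := NonUnitalStarAlgHom.norm_apply_le (rightTensor E H)
    (∑ p ∈ multiIdx n k, (multiCoef p)⁻¹ • (star (A p) * A p))
  simpa only [map_sum, starAlgHom_map_real_smul, map_mul, map_star] using h

/-- Root test: for `r < ρ < 1` the terms are eventually dominated by `(r / ρ) ^ k`. -/
theorem summable_mul_sqrt_of_limsup_le {V : Type*} [NormedAddCommGroup V] {S : ℕ → V}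
    (h : limsup (fun k : ℕ => ‖S k‖ₑ ^ (1 / (2 * (k : ℝ)))) atTop ≤ 1) {r : ℝ} (hr0 : 0 ≤ r)
    (hr1 : r < 1) : Summable fun k : ℕ => r ^ k * √‖S k‖ := by
  obtain ⟨ρ, hrρ, hρ1⟩ := exists_between hr1
  have hρ0 : 0 < ρ := hr0.trans_lt hrρ
  have hc : limsup (fun k : ℕ => ‖S k‖ₑ ^ (1 / (2 * (k : ℝ)))) atTop < ENNReal.ofReal ρ⁻¹ :=
    h.trans_lt (by simpa using (one_lt_inv₀ hρ0).2 hρ1)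
  have hev := eventually_lt_of_limsup_lt hc
  refine Summable.of_norm_bounded_eventually_nat (g := fun k => (r / ρ) ^ k)
    (summable_geometric_of_lt_one (by positivity) ((div_lt_one hρ0).2 hrρ)) ?_
  -- At `k = 0` the exponent `1 / (2 * k)` is `0` by convention and carries no information.
  filter_upwards [hev, eventually_ge_atTop 1] with k hk hk1
  have hk0 : (0 : ℝ) < 2 * k := by
    have : (1 : ℝ) ≤ k := by exact_mod_cast hk1
    linarith
  have h1 : ‖S k‖ₑ ≤ ENNReal.ofReal ((ρ⁻¹ ^ k) ^ 2) := by
    have h2 := ENNReal.rpow_le_rpow hk.le hk0.le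
    rw [← ENNReal.rpow_mul, one_div_mul_cancel hk0.ne', ENNReal.rpow_one,
      ENNReal.ofReal_rpow_of_pos (by positivity)] at h2
    refine h2.trans (le_of_eq ?_)
    rw [← pow_mul, mul_comm k 2]
    congr 1
    exact_mod_cast Real.rpow_natCast ρ⁻¹ (2 * k)
  have h2 : √‖S k‖ ≤ ρ⁻¹ ^ k := by
    refine Real.sqrt_le_iff.2 ⟨by positivity, ?_⟩
    rw [← ofReal_norm] at h1
    exact (ENNReal.ofReal_le_ofReal_iff (by positivity)).1 h1
  rw [Real.norm_of_nonneg (by positivity), div_eq_mul_inv, mul_pow]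
  gcongr

/-- The growth hypothesis has weights `multiCoef p`, the column norm their inverses; since
`multiCoef p ≥ 1` the former controls the latter. -/
theorem summable_mul_colNorm {A : (Fin n → ℕ) → H →L[ℂ] H}
    (hsup : limsup (fun k : ℕ =>
      ‖∑ p ∈ multiIdx n k, multiCoef p • (star (A p) * A p)‖ₑ ^ (1 / (2 * (k : ℝ)))) atTop ≤ 1)
    {r : ℝ} (hr0 : 0 ≤ r) (hr1 : r < 1) : Summable fun k : ℕ => r ^ k * colNorm A k := by
  refine Summable.of_nonneg_of_le (fun k => mul_nonneg (by positivity) (Real.sqrt_nonneg _))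
    (fun k => mul_le_mul_of_nonneg_left (Real.sqrt_le_sqrt ?_) (by positivity))
    (summable_mul_sqrt_of_limsup_le hsup hr0 hr1)
  have h0 : ∀ p : Fin n → ℕ, 0 ≤ star (A p) * A p := fun p => star_mul_self_nonneg _
  refine CStarAlgebra.norm_le_norm_of_nonneg_of_le
    (Finset.sum_nonneg fun p _ => smul_nonneg (inv_nonneg.2 (multiCoef_pos p).le) (h0 p))
    (Finset.sum_le_sum fun p _ => smul_le_smul_of_nonneg_right ?_ (h0 p))
  exact (inv_le_one_of_one_le₀ (one_le_multiCoef p)).trans (one_le_multiCoef p)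

theorem norm_homPart_le (A : (Fin n → ℕ) → H →L[ℂ] H) (k : ℕ) : ‖homPart A k‖ ≤ colNorm A k := by
  have h := norm_sum_opTensor_le (X := symMono (leftCreation (n := n))) (k := k) zero_le_one
    (le_of_le_of_eq (sum_symMono_mul_star_le_one sum_leftCreation_mul_star_le k)
      (by rw [one_pow]; exact (one_smul ℝ _).symm)) A
  rwa [one_mul] at h

/-- Needed before the hypothesis on the real part can be used: a divergent `tsum` would be `0` and
say nothing about `A`. -/
theorem hasSum_symCalculus {A : (Fin n → ℕ) → H →L[ℂ] H} {r : ℝ} (hr0 : 0 ≤ r)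
    (h : Summable fun k : ℕ => r ^ k * colNorm A k) :
    HasSum (fun k : ℕ => (r : ℂ) ^ k • homPart A k)
      (symCalculus A fun i => (r : ℂ) • leftCreation (n := n) i) := by
  have e : ∀ k : ℕ, ∑ p ∈ multiIdx n k,
      opTensor (symMonomial (fun i => (r : ℂ) • leftCreation (n := n) i) p) (A p) =
      (r : ℂ) ^ k • homPart A k := by
    intro k
    rw [homPart, Finset.smul_sum]
    refine Finset.sum_congr rfl fun p hp => ?_
    rw [symMonomial_smul_leftCreation, opTensor_smul_left, mem_multiIdx.1 hp]
  simp only [symCalculus, e]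
  refine (Summable.of_norm_bounded h fun k => ?_).hasSum
  rw [norm_smul, norm_pow, Complex.norm_real, Real.norm_of_nonneg hr0]
  exact mul_le_mul_of_nonneg_left (norm_homPart_le A k) (by positivity)

theorem inner_testVec_symCalculus {A : (Fin n → ℕ) → H →L[ℂ] H} {r : ℝ} (hr0 : 0 ≤ r)
    (h : Summable fun k : ℕ => r ^ k * colNorm A k) {k : ℕ} (hk : k ≠ 0) (z : (Fin n → ℕ) → H) :
    inner ℂ (testVec k z) (symCalculus A (fun i => (r : ℂ) • leftCreation (n := n) i)
      (testVec k z)) =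
      ∑ p ∈ insert 0 (multiIdx n k), ((multiCoef p : ℝ) : ℂ) * inner ℂ (z p) (A 0 (z p)) +
        (r : ℂ) ^ k * ∑ q ∈ multiIdx n k, inner ℂ (z q) (A q (z 0)) := by
  set u := testVec k z with hu
  have h1 := (hasSum_symCalculus hr0 h).mapL (innerSL ℂ u ∘L ContinuousLinearMap.apply ℂ _ u)
  have h2 : HasSum (fun m : ℕ => (r : ℂ) ^ m * inner ℂ u (homPart A m u))
      (∑ m ∈ {0, k}, (r : ℂ) ^ m * inner ℂ u (homPart A m u)) := by
    refine hasSum_sum_of_ne_finset_zero fun m hm => ?_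
    simp only [Finset.mem_insert, Finset.mem_singleton, not_or] at hm
    rw [inner_testVec_homPart_of_ne A hm.1 hm.2, mul_zero]
  rw [Finset.sum_pair hk.symm, inner_testVec_homPart_zero, inner_testVec_homPart_self A hk,
    pow_zero, one_mul] at h2
  refine HasSum.unique ?_ h2
  simpa [inner_smul_right] using h1

theorem re_inner_realPart {G : Type*} [NormedAddCommGroup G] [InnerProductSpace ℂ G]
    [CompleteSpace G] (T : G →L[ℂ] G) (u : G) :
    (inner ℂ u ((ℜ T : G →L[ℂ] G) u)).re = (inner ℂ u (T u)).re := by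
  have e : (ℜ T : G →L[ℂ] G) u = ((2⁻¹ : ℝ) : ℂ) • (T u + star T u) := by
    rw [realPart_apply_coe]; rfl
  rw [e, inner_smul_right, inner_add_right, Complex.re_ofReal_mul, Complex.add_re,
    ContinuousLinearMap.star_eq_adjoint, ContinuousLinearMap.adjoint_inner_right]
  have : (inner ℂ (T u) u).re = (inner ℂ u (T u)).re := inner_re_symm (𝕜 := ℂ) (T u) u
  rw [this]; ring

theorem coeff_inequality {A : (Fin n → ℕ) → H →L[ℂ] H}
    (hsum : ∀ r : ℝ, 0 ≤ r → r < 1 → Summable fun k : ℕ => r ^ k * colNorm A k)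
    (hre : ∀ r : ℝ, 0 ≤ r → r < 1 →
      (ℜ (symCalculus A fun i => (r : ℂ) • leftCreation (n := n) i) :
        HTensor (Fock n) H →L[ℂ] HTensor (Fock n) H) ≤ 1) {k : ℕ} (hk : k ≠ 0)
    (z : (Fin n → ℕ) → H) :
    ∑ q ∈ multiIdx n k, (inner ℂ (z q) (A q (z 0))).re ≤
      ∑ p ∈ insert 0 (multiIdx n k), multiCoef p * (inner ℂ (z p) ((1 - A 0) (z p))).re := by
  set a := ∑ q ∈ multiIdx n k, (inner ℂ (z q) (A q (z 0))).re with ha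
  set b := ∑ p ∈ insert 0 (multiIdx n k), multiCoef p * (inner ℂ (z p) ((1 - A 0) (z p))).re
    with hb
  have key : ∀ r : ℝ, 0 ≤ r → r < 1 → r ^ k * a ≤ b := by
    intro r hr0 hr1
    have hsa : IsSelfAdjoint (ℜ (symCalculus A fun i => (r : ℂ) • leftCreation (n := n) i) :
        HTensor (Fock n) H →L[ℂ] HTensor (Fock n) H) := (ℜ _).2
    have h1 := (clm_le_iff hsa (IsSelfAdjoint.one _)).1
      (hre r hr0 hr1) (testVec k z)
    rw [re_inner_realPart, inner_testVec_symCalculus hr0 (hsum r hr0 hr1) hk,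
      ← opTensor_one, inner_testVec_opTensor_one, ← Complex.ofReal_pow] at h1
    simp only [Complex.add_re, Complex.re_sum, Complex.re_ofReal_mul] at h1
    rw [hb]
    simp only [sub_apply, inner_sub_right, Complex.sub_re, mul_sub, Finset.sum_sub_distrib]
    linarith
  -- Only the left side depends on `r`, so letting `r` increase to `1` removes the factor `r ^ k`.
  have hlim : Tendsto (fun r : ℝ => r ^ k * a) (nhdsWithin 1 (Set.Iio 1)) (nhds a) := by
    have : Tendsto (fun r : ℝ => r ^ k * a) (nhds 1) (nhds (1 ^ k * a)) :=
      (Continuous.tendsto (by fun_prop) 1)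
    rw [one_pow, one_mul] at this
    exact this.mono_left nhdsWithin_le_nhds
  refine le_of_tendsto hlim ?_
  filter_upwards [Ioo_mem_nhdsLT (zero_lt_one' ℝ)] with r hr
  exact key r hr.1.le hr.2

theorem constCoeff_le_one {A : (Fin n → ℕ) → H →L[ℂ] H} (hA0 : 0 ≤ A 0)
    (h : ∀ z : (Fin n → ℕ) → H, ∑ q ∈ multiIdx n 1, (inner ℂ (z q) (A q (z 0))).re ≤
      ∑ p ∈ insert 0 (multiIdx n 1), multiCoef p * (inner ℂ (z p) ((1 - A 0) (z p))).re) :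
    A 0 ≤ 1 := by
  refine (clm_le_iff hA0.isSelfAdjoint (IsSelfAdjoint.one _)).2 fun x => ?_
  have h0 : (0 : Fin n → ℕ) ∉ multiIdx n 1 := fun h => by simpa using mem_multiIdx.1 h
  have hq : ∀ q ∈ multiIdx n 1, (if q = 0 then x else 0) = 0 := fun q hq =>
    if_neg (ne_of_mem_of_not_mem hq h0)
  have h1 := h fun q => if q = 0 then x else 0
  rw [Finset.sum_insert h0, Finset.sum_eq_zero (fun q h => by rw [hq q h]; simp),
    Finset.sum_eq_zero (s := multiIdx n 1) (fun q h => by rw [hq q h]; simp), multiCoef_zero,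
    if_pos rfl] at h1
  simpa [inner_sub_right] using h1

/-- In the coefficient inequality, the vectors of degree `k` are aligned with the images `R A_p R
ξ`, so that the left side becomes the weighted square sum to be bounded. -/
theorem coeffBound {A : (Fin n → ℕ) → H →L[ℂ] H} (hA0 : IsSelfAdjoint (A 0))
    (h : ∀ k : ℕ, k ≠ 0 → ∀ z : (Fin n → ℕ) → H,
      ∑ q ∈ multiIdx n k, (inner ℂ (z q) (A q (z 0))).re ≤
      ∑ p ∈ insert 0 (multiIdx n k), multiCoef p * (inner ℂ (z p) ((1 - A 0) (z p))).re) :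
    CoeffBound A := by
  intro R c hR hc hRc k hk
  refine (sum_smul_star_mul_self_le_iff (multiIdx n k) (fun p => (multiCoef p)⁻¹)
    (fun p => R * A p * R) ((2 * c) ^ 2)).2 fun ξ => ?_
  have h0 : (0 : Fin n → ℕ) ∉ multiIdx n k := fun h => by
    have := mem_multiIdx.1 h
    simp at this; omega
  have hRin : ∀ x y : H, inner ℂ (R x) y = inner ℂ x (R y) := fun x y => by
    rw [← ContinuousLinearMap.adjoint_inner_right, ← ContinuousLinearMap.star_eq_adjoint,
      hR.star_eq]
  have hd : ∀ η : H, (inner ℂ (R η) ((1 - A 0) (R η))).re ≤ c * ‖η‖ ^ 2 := fun η => by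
    rw [hRin]
    refine le_trans ?_ (re_inner_smul_one c η).le
    refine (clm_le_iff ?_ (isSelfAdjoint_real_smul (IsSelfAdjoint.one _) c)).1 hRc η
    rw [IsSelfAdjoint, star_mul, star_mul, hR.star_eq, star_sub, star_one, hA0.star_eq, mul_assoc]
  set w : (Fin n → ℕ) → H := fun p => (R * A p * R) ξ with hw
  -- The inequality will read `t s ≤ c ‖ξ‖² + c t² s`; this `t` maximizes `t - c t²`, with value `1
  -- / (4c)`, whence `s ≤ (2c)² ‖ξ‖²`.
  set t : ℝ := (2 * c)⁻¹ with ht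
  set z : (Fin n → ℕ) → H := fun p =>
    if p = 0 then R ξ else R (((t * (multiCoef p)⁻¹ : ℝ) : ℂ) • w p) with hz
  have h1 := h k (by omega) z
  have hz0 : z 0 = R ξ := if_pos rfl
  have hzq : ∀ q ∈ multiIdx n k, z q = R (((t * (multiCoef q)⁻¹ : ℝ) : ℂ) • w q) := fun q hq =>
    if_neg (ne_of_mem_of_not_mem hq h0)
  set s := ∑ p ∈ multiIdx n k, (multiCoef p)⁻¹ * ‖w p‖ ^ 2 with hs
  have e1 : ∑ q ∈ multiIdx n k, (inner ℂ (z q) (A q (z 0))).re = t * s := by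
    rw [hs, Finset.mul_sum]
    refine Finset.sum_congr rfl fun q hq => ?_
    rw [hzq q hq, hz0, hRin, inner_smul_left, Complex.conj_ofReal, Complex.re_ofReal_mul, mul_assoc]
    congr 2
    exact_mod_cast congrArg Complex.re (inner_self_eq_norm_sq_to_K (𝕜 := ℂ) (w q))
  have e2 : ∑ p ∈ insert 0 (multiIdx n k), multiCoef p * (inner ℂ (z p) ((1 - A 0) (z p))).re ≤
      c * ‖ξ‖ ^ 2 + c * t ^ 2 * s := by
    rw [Finset.sum_insert h0, hz0, multiCoef_zero, one_mul, hs, Finset.mul_sum]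
    refine add_le_add (hd ξ) (Finset.sum_le_sum fun q hq => ?_)
    have hq0 := multiCoef_pos q
    rw [hzq q hq]
    calc _ ≤ multiCoef q * (c * ‖((t * (multiCoef q)⁻¹ : ℝ) : ℂ) • w q‖ ^ 2) :=
          mul_le_mul_of_nonneg_left (hd _) hq0.le
      _ = _ := by
          rw [norm_smul, Complex.norm_real, mul_pow, Real.norm_eq_abs, sq_abs]
          field_simp
  rw [e1] at h1
  have h2 := h1.trans e2
  have ht' : t = 1 / (2 * c) := by rw [ht, one_div]
  rw [ht'] at h2
  have h3 : s / (4 * c) ≤ c * ‖ξ‖ ^ 2 := by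
    have : 1 / (2 * c) * s - c * (1 / (2 * c)) ^ 2 * s = s / (4 * c) := by field_simp; ring
    linarith
  rw [div_le_iff₀ (by positivity)] at h3
  change s ≤ _
  linarith

end Coefficients

/-! ### From the coefficient bound to the five estimates -/

section Consequences

variable {n : ℕ} {H : Type*} [NormedAddCommGroup H] [InnerProductSpace ℂ H] [CompleteSpace H]

theorem norm_one_sub_nonneg_le {A : (Fin n → ℕ) → H →L[ℂ] H} (hA : A 0 ≤ 1) {c : ℝ}
    (hc : ‖1 - A 0‖ ≤ c) : 1 - A 0 ≤ c • (1 : H →L[ℂ] H) :=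
  (le_norm_smul_one (sub_nonneg.2 hA).isSelfAdjoint).trans
    (smul_le_smul_of_nonneg_right hc (zero_le_one' (H →L[ℂ] H)))

theorem colNorm_le_of_coeffBound {A : (Fin n → ℕ) → H →L[ℂ] H} (hA1 : A 0 ≤ 1)
    (hA : CoeffBound A) {k : ℕ} (hk : 1 ≤ k) : colNorm A k ≤ 2 * ‖1 - A 0‖ := by
  refine le_of_forall_pos_le_add fun ε hε => ?_
  -- `CoeffBound` asks for `c > 0`, while `1 - A 0` may vanish.
  set c := ‖1 - A 0‖ + ε / 2 with hc
  have hc0 : 0 < c := by positivity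
  have h := hA 1 c (IsSelfAdjoint.one _) hc0
    (by simpa using norm_one_sub_nonneg_le hA1 (le_add_of_nonneg_right (by positivity))) k hk
  simp only [one_mul, mul_one] at h
  have h2 := norm_le_of_le_smul_one (Finset.sum_nonneg fun p _ =>
    smul_nonneg (inv_nonneg.2 (multiCoef_pos p).le) (star_mul_self_nonneg (A p))) h (by positivity)
  calc colNorm A k ≤ √((2 * c) ^ 2) := Real.sqrt_le_sqrt h2
    _ = 2 * ‖1 - A 0‖ + ε := by rw [Real.sqrt_sq (by positivity), hc]; ring

theorem colNorm_zero (A : (Fin n → ℕ) → H →L[ℂ] H) : colNorm A 0 = ‖A 0‖ := by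
  have h : ∑ p ∈ multiIdx n 0, (multiCoef p)⁻¹ • (star (A p) * A p) = star (A 0) * A 0 := by
    rw [multiIdx_zero, Finset.sum_singleton, multiCoef_zero, inv_one, one_smul]
  rw [colNorm, h, CStarRing.norm_star_mul_self, Real.sqrt_mul_self (norm_nonneg _)]

theorem colNorm_nonneg (A : (Fin n → ℕ) → H →L[ℂ] H) (k : ℕ) : 0 ≤ colNorm A k :=
  Real.sqrt_nonneg _

/-- The radius `1/3` is where `2 (r + r² + ⋯)` reaches `1`. -/
theorem bohr_sum_le {a : ℕ → ℝ} {d : ℝ} (ha : ∀ k, 0 ≤ a k) (h : ∀ k, 1 ≤ k → a k ≤ 2 * d) {r : ℝ}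
    (hr0 : 0 ≤ r) (hr : r ≤ 1 / 3) :
    Summable (fun k => r ^ k * a k) ∧ ∑' k, r ^ k * a k ≤ a 0 + d := by
  have hd : 0 ≤ 2 * d := (ha 1).trans (h 1 le_rfl)
  have hterm : ∀ k, r ^ (k + 1) * a (k + 1) ≤ 2 * d * (1 / 3) * (1 / 3) ^ k := by
    intro k
    calc _ ≤ (1 / 3) ^ (k + 1) * (2 * d) := by gcongr; exacts [ha _, h _ (by omega)]
      _ = _ := by ring
  have hg : HasSum (fun k : ℕ => 2 * d * (1 / 3) * (1 / 3 : ℝ) ^ k) d := by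
    have := (hasSum_geometric_of_lt_one (r := (1 / 3 : ℝ)) (by norm_num) (by norm_num)).mul_left
      (2 * d * (1 / 3))
    have e : 2 * d * (1 / 3) * (1 - 1 / 3 : ℝ)⁻¹ = d := by norm_num; ring
    rwa [e] at this
  have hs1 : Summable fun k => r ^ (k + 1) * a (k + 1) :=
    Summable.of_nonneg_of_le (fun k => mul_nonneg (by positivity) (ha _)) hterm hg.summable
  have hs : Summable fun k => r ^ k * a k := (summable_nat_add_iff 1).1 hs1
  refine ⟨hs, ?_⟩
  rw [hs.tsum_eq_zero_add, pow_zero, one_mul]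
  gcongr
  exact (hs1.tsum_le_tsum hterm hg.summable).trans hg.tsum_eq.le

/-- The weighted column norms of a family contract under a ⋆-homomorphism. -/
theorem norm_sum_map_star_mul_le {M L : Type*} [CStarAlgebra M] [CStarAlgebra L] {k : ℕ}
    (π : M →⋆ₐ[ℂ] L) (Y : (Fin n → ℕ) → M) :
    √‖∑ p ∈ multiIdx n k, multiCoef p • (star (π (Y p)) * π (Y p))‖ ≤
      √‖∑ p ∈ multiIdx n k, multiCoef p • (star (Y p) * Y p)‖ := by
  refine Real.sqrt_le_sqrt ?_
  have h := NonUnitalStarAlgHom.norm_apply_le π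
    (∑ p ∈ multiIdx n k, multiCoef p • (star (Y p) * Y p))
  simpa only [map_sum, starAlgHom_map_real_smul, map_mul, map_star] using h

theorem norm_tsum_map_map_le_one {N M L : Type*} [CStarAlgebra N] [CStarAlgebra M] [PartialOrder M]
    [StarOrderedRing M] [CStarAlgebra L] [PartialOrder L] [StarOrderedRing L]
    (π : M →⋆ₐ[ℂ] L) (ψ : N →⋆ₐ[ℂ] L) (hψ : ∀ b a, Commute (ψ b) (π a)) {A : (Fin n → ℕ) → M}
    (hA0 : 0 ≤ A 0) (hA1 : A 0 ≤ 1) (hA : CoeffBound A) {x : (Fin n → ℕ) → L}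
    (hx0 : x 0 = 1) (hx : ∀ k, ∑ p ∈ multiIdx n k, multiCoef p • (x p * star (x p)) ≤ 1)
    (hxc : ∀ p a, Commute (x p) (π a)) {Y : (Fin n → ℕ) → N} (hy0 : ‖Y 0‖ ≤ 1)
    (hys : Summable fun k : ℕ => √‖∑ p ∈ multiIdx n (k + 1), multiCoef p • (star (Y p) * Y p)‖)
    (hy : ∑' k : ℕ, √‖∑ p ∈ multiIdx n (k + 1), multiCoef p • (star (Y p) * Y p)‖ ≤ 1 / 2) :
    Summable (fun k : ℕ => ∑ p ∈ multiIdx n k, x p * π (A p) * ψ (Y p)) ∧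
      ‖∑' k : ℕ, ∑ p ∈ multiIdx n k, x p * π (A p) * ψ (Y p)‖ ≤ 1 := by
  have hle : ∀ k : ℕ, _ := fun k : ℕ => norm_sum_map_star_mul_le (k := k + 1) ψ Y
  have hs := Summable.of_nonneg_of_le (fun k => Real.sqrt_nonneg _) hle hys
  exact norm_tsum_map_le_one π hA0 hA1 hA hx0 hx hxc (fun p a => hψ _ a)
    ((NonUnitalStarAlgHom.norm_apply_le ψ _).trans hy0) hs ((hs.tsum_le_tsum hle hys).trans hy)

theorem tuplePow_algebraMap {L : Type*} [CStarAlgebra L] (z : EuclideanSpace ℂ (Fin n))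
    (p : Fin n → ℕ) : tuplePow (fun i => algebraMap ℂ L (z i)) p = monomialAt z p • (1 : L) := by
  rw [← Algebra.algebraMap_eq_smul_one, monomialAt, ← List.prod_ofFn, map_list_prod, List.map_ofFn,
    tuplePow]
  congr 2
  funext i
  simp

/-- The coordinates of `z`, seen as scalar operators, form a commuting row contraction. -/
theorem sum_monomialAt_smul_one_le {L : Type*} [CStarAlgebra L] [PartialOrder L]
    [StarOrderedRing L] {z : EuclideanSpace ℂ (Fin n)} (hz : ‖z‖ ≤ 1) (k : ℕ) :
    ∑ p ∈ multiIdx n k, multiCoef p •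
      ((monomialAt z p • (1 : L)) * star (monomialAt z p • (1 : L))) ≤ 1 := by
  simp only [← tuplePow_algebraMap]
  refine sum_tuplePow_mul_star_le_one (fun i j => Algebra.commutes _ _) ?_ k
  have e : ∑ i, algebraMap ℂ L (z i) * star (algebraMap ℂ L (z i)) = (‖z‖ ^ 2) • (1 : L) := by
    rw [EuclideanSpace.norm_sq_eq, Finset.sum_smul]
    refine Finset.sum_congr rfl fun i _ => ?_
    rw [← algebraMap_star_comm, ← map_mul, ← starRingEnd_apply, Complex.mul_conj',
      Algebra.algebraMap_eq_smul_one, ← Complex.ofReal_pow, Complex.coe_smul]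
  rw [e]
  simpa using smul_le_smul_of_nonneg_right (pow_le_one₀ (norm_nonneg z) hz) (zero_le_one' L)

theorem norm_tsum_tuplePow_le_one {A : (Fin n → ℕ) → H →L[ℂ] H} (hA0 : 0 ≤ A 0) (hA1 : A 0 ≤ 1)
    (hA : CoeffBound A) {E K G : Type*}
    [NormedAddCommGroup E] [InnerProductSpace ℂ E] [CompleteSpace E] {X : Fin n → E →L[ℂ] E}
    (hX : ∀ i j, Commute (X i) (X j)) (hX1 : ∑ i, X i * star (X i) ≤ 1)
    [NormedAddCommGroup K] [InnerProductSpace ℂ K]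
    [CompleteSpace K] [NormedAddCommGroup G] [InnerProductSpace ℂ G] [CompleteSpace G]
    (π : (H →L[ℂ] H) →⋆ₐ[ℂ] (G →L[ℂ] G)) (ψ : (K →L[ℂ] K) →⋆ₐ[ℂ] (G →L[ℂ] G))
    (hψ : ∀ b a, Commute (ψ b) (π a)) {Y : (Fin n → ℕ) → K →L[ℂ] K} (hy0 : ‖Y 0‖ ≤ 1)
    (hys : Summable fun k : ℕ => √‖∑ p ∈ multiIdx n (k + 1), multiCoef p • (star (Y p) * Y p)‖)
    (hy : ∑' k : ℕ, √‖∑ p ∈ multiIdx n (k + 1), multiCoef p • (star (Y p) * Y p)‖ ≤ 1 / 2) :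
    Summable (fun k : ℕ => ∑ p ∈ multiIdx n k,
      opTensor (tuplePow X p) (π (A p) * ψ (Y p))) ∧
    ‖∑' k : ℕ, ∑ p ∈ multiIdx n k,
      opTensor (tuplePow X p) (π (A p) * ψ (Y p))‖ ≤ 1 := by
  have h := norm_tsum_map_map_le_one ((rightTensor E G).comp π)
    ((rightTensor E G).comp ψ) (fun b a => (hψ b a).map (rightTensor E G))
    hA0 hA1 hA (x := fun p => leftTensor E G (tuplePow X p))
    (by rw [tuplePow_zero, map_one]) (fun k => ?_) (fun p a => commute_left_right _ _) hy0 hys hy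
  · simpa only [opTensor_eq_left_mul_right, map_mul, mul_assoc, StarAlgHom.comp_apply] using h
  · have h1 := OrderHomClass.mono (leftTensor E G)
      (sum_tuplePow_mul_star_le_one hX hX1 k)
    simpa only [map_sum, starAlgHom_map_real_smul, map_mul, map_star, map_one] using h1

theorem norm_tsum_monomialAt_le_one {A : (Fin n → ℕ) → H →L[ℂ] H} (hA0 : 0 ≤ A 0) (hA1 : A 0 ≤ 1)
    (hA : CoeffBound A) {K : Type*} [NormedAddCommGroup K] [InnerProductSpace ℂ K]
    [CompleteSpace K] {Y : (Fin n → ℕ) → K →L[ℂ] K} (hy0 : ‖Y 0‖ ≤ 1)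
    (hys : Summable fun k : ℕ => √‖∑ p ∈ multiIdx n (k + 1), multiCoef p • (star (Y p) * Y p)‖)
    (hy : ∑' k : ℕ, √‖∑ p ∈ multiIdx n (k + 1), multiCoef p • (star (Y p) * Y p)‖ ≤ 1 / 2)
    {z : EuclideanSpace ℂ (Fin n)} (hz : ‖z‖ ≤ 1) :
    Summable (fun k : ℕ => ∑ p ∈ multiIdx n k, monomialAt z p • opTensor (A p) (Y p)) ∧
    ‖∑' k : ℕ, ∑ p ∈ multiIdx n k, monomialAt z p • opTensor (A p) (Y p)‖ ≤ 1 := by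
  have h := norm_tsum_map_map_le_one (leftTensor H K) (rightTensor H K)
    (fun b a => (commute_left_right _ _).symm) hA0 hA1 hA
    (x := fun p => monomialAt z p • (1 : HTensor H K →L[ℂ] HTensor H K))
    (by simp [monomialAt]) (fun k => ?_) (fun p a => (Commute.one_left _).smul_left _) hy0 hys hy
  · simpa only [opTensor_eq_left_mul_right, smul_mul_assoc, one_mul] using h
  · exact sum_monomialAt_smul_one_le hz k

theorem norm_sum_opTensor_tuplePow_le {K : Type*} [NormedAddCommGroup K] [InnerProductSpace ℂ K]
    [CompleteSpace K] {T : Fin n → K →L[ℂ] K} (hT : ∀ i j, Commute (T i) (T j)) {c : ℝ}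
    (h : √‖∑ i, T i * star (T i)‖ ≤ c) (A : (Fin n → ℕ) → H →L[ℂ] H) (k : ℕ) :
    ‖∑ p ∈ multiIdx n k, opTensor (tuplePow T p) (A p)‖ ≤ c ^ k * colNorm A k := by
  have hc : 0 ≤ c := (Real.sqrt_nonneg _).trans h
  have h1 : ∑ i, T i * star (T i) ≤ c ^ 2 • (1 : K →L[ℂ] K) := by
    have hnn : 0 ≤ ∑ i, T i * star (T i) := Finset.sum_nonneg fun i _ => mul_star_self_nonneg _
    refine (le_norm_smul_one hnn.isSelfAdjoint).trans
      (smul_le_smul_of_nonneg_right ?_ (zero_le_one' (K →L[ℂ] K)))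
    exact (Real.sqrt_le_left hc).1 h
  refine norm_sum_opTensor_le (by positivity) ?_ A
  rw [← pow_mul, mul_comm k 2, pow_mul]
  exact sum_tuplePow_mul_star_le hT h1 (by positivity) k

theorem sqrt_norm_sum_tuplePow_le {K : Type*} [NormedAddCommGroup K] [InnerProductSpace ℂ K]
    [CompleteSpace K] {Y : Fin n → K →L[ℂ] K} (hY : ∀ i j, Commute (Y i) (Y j)) {c : ℝ}
    (hc : 0 ≤ c) (h : ‖rowOp fun i => star (Y i)‖ ≤ c) (k : ℕ) :
    √‖∑ p ∈ multiIdx n k, multiCoef p • (star (tuplePow Y p) * tuplePow Y p)‖ ≤ c ^ k := by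
  have h1 : ∑ i, star (Y i) * Y i ≤ c ^ 2 • (1 : K →L[ℂ] K) :=
    (sum_star_mul_self_le_iff Finset.univ Y (c ^ 2)).2
      (sum_norm_sq_le_of_norm_rowOp_star_le hc h)
  have h2 := norm_le_of_le_smul_one (Finset.sum_nonneg fun p _ =>
    smul_nonneg (multiCoef_pos p).le (star_mul_self_nonneg (tuplePow Y p)))
    (sum_star_tuplePow_mul_le hY h1 (by positivity) k) (by positivity)
  refine Real.sqrt_le_iff.2 ⟨by positivity, ?_⟩
  rwa [← pow_mul, mul_comm k 2, pow_mul]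

end Consequences

end BohrFock

end

/-! ### Proof of the theorem -/

theorem theorem4p1 {n : ℕ} (hn : 1 ≤ n)
    {H : Type*} [NormedAddCommGroup H] [InnerProductSpace ℂ H] [CompleteSpace H]
    (A : (Fin n → ℕ) → H →L[ℂ] H) (f : EuclideanSpace ℂ (Fin n) → H →L[ℂ] H)
    (hf : ∀ z ∈ Metric.ball (0 : EuclideanSpace ℂ (Fin n)) 1,
      HasSum (fun p : Fin n → ℕ => monomialAt z p • A p) (f z))
    (hsup : limsup (fun k : ℕ =>
      ‖∑ p ∈ multiIdx n k, multiCoef p • (star (A p) * A p)‖ₑ ^ (1 / (2 * (k : ℝ)))) atTop ≤ 1)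
    (hf0 : 0 ≤ f 0)
    (hre : ∀ r : ℝ, 0 ≤ r → r < 1 →
      (ℜ (symCalculus A fun i => (r : ℂ) • leftCreation (n := n) i) :
        HTensor (Fock n) H →L[ℂ] HTensor (Fock n) H) ≤ 1) :
    -- (i)
    (∀ k : ℕ, 1 ≤ k →
      √‖∑ p ∈ multiIdx n k, (multiCoef p)⁻¹ • (star (A p) * A p)‖ ≤ 2 * ‖1 - A 0‖) ∧
    -- (ii)
    (∀ r : ℝ, 0 ≤ r → r ≤ 1 / 3 →
      Summable (fun k : ℕ =>
        r ^ k * √‖∑ p ∈ multiIdx n k, (multiCoef p)⁻¹ • (star (A p) * A p)‖) ∧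
      ∑' k : ℕ, r ^ k * √‖∑ p ∈ multiIdx n k, (multiCoef p)⁻¹ • (star (A p) * A p)‖
        ≤ ‖A 0‖ + ‖1 - A 0‖) ∧
    -- (iii)
    (∀ (K : Type*) [NormedAddCommGroup K] [InnerProductSpace ℂ K] [CompleteSpace K]
      (Y : (Fin n → ℕ) → K →L[ℂ] K),
      ‖Y 0‖ ≤ 1 →
      Summable (fun k : ℕ =>
        √‖∑ p ∈ multiIdx n (k + 1), multiCoef p • (star (Y p) * Y p)‖) →
      ∑' k : ℕ, √‖∑ p ∈ multiIdx n (k + 1), multiCoef p • (star (Y p) * Y p)‖ ≤ 1 / 2 →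
      (Summable (fun k : ℕ => ∑ p ∈ multiIdx n k,
          opTensor (tuplePow symCreation p) (opTensor (A p) (Y p))) ∧
        ‖∑' k : ℕ, ∑ p ∈ multiIdx n k,
          opTensor (tuplePow symCreation p) (opTensor (A p) (Y p))‖ ≤ 1) ∧
      ∀ z ∈ Metric.ball (0 : EuclideanSpace ℂ (Fin n)) 1,
        Summable (fun k : ℕ => ∑ p ∈ multiIdx n k, monomialAt z p • opTensor (A p) (Y p)) ∧
        ‖∑' k : ℕ, ∑ p ∈ multiIdx n k, monomialAt z p • opTensor (A p) (Y p)‖ ≤ 1) ∧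
    -- (iv)
    (∀ (K : Type*) [NormedAddCommGroup K] [InnerProductSpace ℂ K] [CompleteSpace K]
      (Y : Fin n → K →L[ℂ] K),
      (∀ i j, Commute (Y i) (Y j)) →
      ‖rowOp fun i => star (Y i)‖ ≤ 1 / 3 →
      Summable (fun k : ℕ => ∑ p ∈ multiIdx n k,
        opTensor (tuplePow symCreation p) (opTensor (tuplePow Y p) (A p))) ∧
      ‖∑' k : ℕ, ∑ p ∈ multiIdx n k,
        opTensor (tuplePow symCreation p) (opTensor (tuplePow Y p) (A p))‖ ≤ 1) ∧
    -- (v)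
    (∀ (K : Type*) [NormedAddCommGroup K] [InnerProductSpace ℂ K] [CompleteSpace K]
      (T : Fin n → K →L[ℂ] K),
      (∀ i j, Commute (T i) (T j)) →
      √‖∑ i, T i * star (T i)‖ ≤ 1 / 3 →
      Summable (fun k : ℕ => ‖∑ p ∈ multiIdx n k, opTensor (tuplePow T p) (A p)‖) ∧
      ∑' k : ℕ, ‖∑ p ∈ multiIdx n k, opTensor (tuplePow T p) (A p)‖ ≤ ‖A 0‖ + ‖1 - A 0‖) := by
  have hsum : ∀ r : ℝ, 0 ≤ r → r < 1 → Summable fun k : ℕ => r ^ k * colNorm A k :=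
    fun r hr0 hr1 => summable_mul_colNorm hsup hr0 hr1
  have hfA : f 0 = A 0 := by
    have h0 := hf 0 (Metric.mem_ball_self one_pos)
    have h1 : HasSum (fun p : Fin n → ℕ => monomialAt (0 : EuclideanSpace ℂ (Fin n)) p • A p)
        (monomialAt (0 : EuclideanSpace ℂ (Fin n)) 0 • A 0) := by
      refine hasSum_single 0 fun p hp => ?_
      obtain ⟨i, hi⟩ := Function.ne_iff.1 hp
      have : monomialAt (0 : EuclideanSpace ℂ (Fin n)) p = 0 :=
        Finset.prod_eq_zero (Finset.mem_univ i) (by simpa using hi)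
      rw [this, zero_smul]
    rw [h0.unique h1]
    simp [monomialAt]
  have hA0 : 0 ≤ A 0 := hfA ▸ hf0
  have hcoef : ∀ k : ℕ, k ≠ 0 → ∀ z : (Fin n → ℕ) → H, _ := fun k hk z =>
    coeff_inequality hsum hre hk z
  have hA1 : A 0 ≤ 1 := constCoeff_le_one hA0 (hcoef 1 one_ne_zero)
  have hA : CoeffBound A := coeffBound hA0.isSelfAdjoint hcoef
  have hcol : ∀ k, 1 ≤ k → colNorm A k ≤ 2 * ‖1 - A 0‖ := fun k hk =>
    colNorm_le_of_coeffBound hA1 hA hk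
  have hbohr : ∀ r : ℝ, 0 ≤ r → r ≤ 1 / 3 → Summable (fun k => r ^ k * colNorm A k) ∧
      ∑' k, r ^ k * colNorm A k ≤ ‖A 0‖ + ‖1 - A 0‖ := fun r hr0 hr => by
    rw [← colNorm_zero]
    exact bohr_sum_le (colNorm_nonneg A) hcol hr0 hr
  refine ⟨hcol, hbohr, ?_, ?_, ?_⟩
  · intro K _ _ _ Y hy0 hys hy
    refine ⟨?_, fun z hz => norm_tsum_monomialAt_le_one hA0 hA1 hA hy0 hys hy
      (mem_ball_zero_iff.1 hz).le⟩
    have h := norm_tsum_tuplePow_le_one hA0 hA1 hA commute_symCreation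
      sum_symCreation_mul_star_le (leftTensor H K) (rightTensor H K)
      (fun b a => (commute_left_right a b).symm) hy0 hys hy
    simpa only [← opTensor_eq_left_mul_right] using h
  · intro K _ _ _ Y hY hrow
    have hle := fun k : ℕ => sqrt_norm_sum_tuplePow_le hY (by norm_num) hrow (k + 1)
    -- Here `1/3 + 1/9 + ⋯ = 1/2` is exactly the budget for the `Y_p` with `p ≠ 0`.
    have hg : HasSum (fun k : ℕ => (1 / 3 : ℝ) ^ (k + 1)) (1 / 2) := by
      have := (hasSum_geometric_of_lt_one (r := (1 / 3 : ℝ)) (by norm_num) (by norm_num)).mul_left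
        (1 / 3)
      simp only [← pow_succ'] at this
      rwa [show (1 / 3 : ℝ) * (1 - 1 / 3)⁻¹ = 1 / 2 by norm_num] at this
    have hs := Summable.of_nonneg_of_le (fun _ => Real.sqrt_nonneg _) hle hg.summable
    have hy0 : ‖tuplePow Y 0‖ ≤ 1 := by
      rw [tuplePow_zero]; exact ContinuousLinearMap.norm_id_le
    have h := norm_tsum_tuplePow_le_one hA0 hA1 hA commute_symCreation
      sum_symCreation_mul_star_le (rightTensor K H) (leftTensor K H)
      commute_left_right hy0 hs ((hs.tsum_le_tsum hle hg.summable).trans hg.tsum_eq.le)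
    -- The general estimate has the factor of `A p` before that of `Y^p`; commuting them gives the
    -- order of tensor factors in (iv).
    simpa only [← (commute_left_right _ _).eq, ← opTensor_eq_left_mul_right] using h
  · intro K _ _ _ T hT hnorm
    have hle := norm_sum_opTensor_tuplePow_le hT hnorm A
    obtain ⟨h1, h2⟩ := hbohr (1 / 3) (by norm_num) le_rfl
    have hs := Summable.of_nonneg_of_le (fun _ => norm_nonneg _) hle h1
    exact ⟨hs, (hs.tsum_le_tsum hle h1).trans h2⟩
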